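/- **Setting.** Let $d\ge 2$ and $T\in\mathbb N$. Let $\mathcal X\subseteq\mathbb R^d$ be closed and star-convex about the origin, with $\|x\|\le 1$ for all $x\in\mathcal X$. Let $b>0$, $S_a,S_\theta>0$ with $\nu:=b/S_a\le 1$, and let $\theta,a\in\mathbb R^d$ satisfy $\|\theta\|\le S_\theta$, $\|a\|\le S_a$. Put $S:=\max(S_a,S_\theta)$, and let $\rho\ge 0$, $\delta\in(0,1)$, $\lambda\ge 1$. Let $x_*$ maximize $\theta^\top x$ over $\mathcal Y:=\{x\in\mathcal X: a^\top x\le b\}$ and assume $\theta^\top x_*>0$. In each round $t\in\{1,\dots,T\}$ an action $x_t\in\mathcal X$ is played and $y_t=\theta^\top x_t+\epsilon_t$, $z_t=a^\top x_t+\eta_t$ are observed. The noise satisfies, for each $t\in\{1,\dots,T\}$, $\mathbb E[\epsilon_t\mid x_1,\epsilon_1,\dots,\epsilon_{t-1},x_t]=0$ and $\mathbb E[\exp(s\epsilon_t)\mid x_1,\epsilon_1,\dots,\epsilon_{t-1},x_t]\le\exp(s^2\rho^2/2)$ for all $s\in\mathbb R$; the same holds with $\eta$ in place of $\epsilon$ throughout.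 **Algorithm.** For a positive definite matrix $M$ let $\|x\|_M=\sqrt{x^\top Mx}$. Let $V_t=\lambda I+\sum_{k<t}x_kx_k^\top$, $\hat\theta_t=V_t^{-1}\sum_{k<t}x_ky_k$, $\hat a_t=V_t^{-1}\sum_{k<t}x_kz_k$, and $$\beta_t=\rho\sqrt{d\log\Big(\frac{1+(t-1)/\lambda}{\delta/2}\Big)}+\sqrt\lambda\,S .$$ Let $$\mathcal Y_t^p=\{x\in\mathcal X:\hat a_t^\top x+\beta_t\|x\|_{V_t^{-1}}\le b\},\qquad \mathcal Y_t^o=\{x\in\mathcal X:\hat a_t^\top x-\beta_t\|x\|_{V_t^{-1}}\le b\},$$ let $\hat{\mathcal Y}_t^p=\mathcal Y_t^p\cup\{x\in\mathcal Y_t^o:\|x\|\le\nu\}$, and let $\bar{\mathcal Y}_t^p=\{x\in\hat{\mathcal Y}_t^p:\zeta x\notin\hat{\mathcal Y}_t^p\ \forall\zeta>1\}$ be its maximally scaled part. For $x\in\bar{\mathcal Y}_t^p$ let $\alpha_t(x)=\max\{\mu\ge 0:\mu x\in\mathcal Y_t^o\}$, $$\kappa_t(x)=(\alpha_t(x)-1)\frac{\hat\theta_t^\top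 x}{\beta_t\|x\|_{V_t^{-1}}}+\alpha_t(x),\qquad \tilde\kappa_t(x)=\min\Big(\kappa_t(x),\,1+\frac{2S_\theta}{b}\Big).$$ The algorithm C-ROFUL plays in every round $t\in\{1,\dots,T\}$ an action $$x_t\in\operatorname*{argmax}_{x\in\bar{\mathcal Y}_t^p}\Big(\hat\theta_t^\top x+\tilde\kappa_t(x)\,\beta_t\|x\|_{V_t^{-1}}\Big)$$ (and an arbitrary $x_t\in\mathcal X$ in case that no maximizer exists). **Claim.** With probability at least $1-\delta$, the regret $R_T=\sum_{t=1}^T\theta^\top(x_*-x_t)$ of C-ROFUL satisfies $$R_T\le 2\Big(1+\frac{S_\theta}{b}\Big)\beta_T\sqrt{2dT\log\Big(1+\frac{T}{\lambda d}\Big)} .$$ -/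

import Mathlib

open MeasureTheory

noncomputable section

namespace SafeLinearBandit

/-- The quantities known to the learner: the action set `X`, the constraint limit `b`, the bounds
`Sa`, `Sθ` on the norms of the constraint vector and of the reward vector, the subgaussian
parameter `ρ` of the noise, the confidence level `δ` and the regularization parameter `lam`. -/
structure Input (d : ℕ) where
  X : Set (EuclideanSpace ℝ (Fin d))
  b : ℝ
  Sa : ℝ
  Sθ : ℝ
  ρ : ℝ
  δ : ℝ
  lam : ℝ

variable {d : ℕ}

/-- The weighted norm `‖x‖_M = √(xᵀ M x)`. -/
def wnorm (M : Matrix (Fin d) (Fin d) ℝ) (x : EuclideanSpace ℝ (Fin d)) : ℝ :=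
  Real.sqrt (x.ofLp ⬝ᵥ M.mulVec x.ofLp)

/-- The points of `D` that cannot be scaled up further while staying in `D`. -/
def maxScaled (D : Set (EuclideanSpace ℝ (Fin d))) : Set (EuclideanSpace ℝ (Fin d)) :=
  {x | x ∈ D ∧ ∀ ζ : ℝ, 1 < ζ → ζ • x ∉ D}

/-- The maximizers of `f` over `D`. -/
def argmaxOn (f : EuclideanSpace ℝ (Fin d) → ℝ) (D : Set (EuclideanSpace ℝ (Fin d))) :
    Set (EuclideanSpace ℝ (Fin d)) :=
  {x | x ∈ D ∧ ∀ x' ∈ D, f x' ≤ f x}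

namespace Input

/-- `S = max (Sa, Sθ)`. -/
def S (P : Input d) : ℝ := max P.Sa P.Sθ

/-- `ν = b / Sa`. -/
def ν (P : Input d) : ℝ := P.b / P.Sa

/-- The confidence radius of round `t`. -/
def β (P : Input d) (t : ℕ) : ℝ :=
  P.ρ * Real.sqrt (d * Real.log ((1 + ((t : ℝ) - 1) / P.lam) / (P.δ / 2)))
    + Real.sqrt P.lam * P.S

/-! Rounds are numbered `1, 2, …`. Below, `x k` is the action played in round `k`, and `y k`, `z k`
are the observed reward and constraint value. What is indexed by `t` uses the rounds
`1, …, t - 1` only. -/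

/-- The regularized Gram matrix `V_t`. -/
def V (P : Input d) (x : ℕ → EuclideanSpace ℝ (Fin d)) (t : ℕ) : Matrix (Fin d) (Fin d) ℝ :=
  ∑ k ∈ Finset.Ico 1 t, Matrix.vecMulVec (x k).ofLp (x k).ofLp + P.lam • 1

/-- The regularized least squares estimate `V_t⁻¹ ∑_{k < t} w_k x_k` from the observations `w`. It is
the estimate of the reward vector for `w = y`, of the constraint vector for `w = z`. -/
def est (P : Input d) (x : ℕ → EuclideanSpace ℝ (Fin d)) (w : ℕ → ℝ) (t : ℕ) :
    EuclideanSpace ℝ (Fin d) :=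
  WithLp.toLp 2 ((P.V x t)⁻¹.mulVec (∑ k ∈ Finset.Ico 1 t, w k • (x k).ofLp))

/-- The confidence width `β_t ‖v‖_{V_t⁻¹}` at the point `v`. -/
def width (P : Input d) (x : ℕ → EuclideanSpace ℝ (Fin d)) (t : ℕ)
    (v : EuclideanSpace ℝ (Fin d)) : ℝ :=
  P.β t * wnorm (P.V x t)⁻¹ v

/-- The pessimistic action set. -/
def pess (P : Input d) (x : ℕ → EuclideanSpace ℝ (Fin d)) (z : ℕ → ℝ) (t : ℕ) :
    Set (EuclideanSpace ℝ (Fin d)) :=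
  {v | v ∈ P.X ∧ inner ℝ (P.est x z t) v + P.width x t v ≤ P.b}

/-- The optimistic action set. -/
def opt (P : Input d) (x : ℕ → EuclideanSpace ℝ (Fin d)) (z : ℕ → ℝ) (t : ℕ) :
    Set (EuclideanSpace ℝ (Fin d)) :=
  {v | v ∈ P.X ∧ inner ℝ (P.est x z t) v - P.width x t v ≤ P.b}

/-- The pessimistic set enlarged by the optimistic actions of norm at most `ν`. -/
def pessHat (P : Input d) (x : ℕ → EuclideanSpace ℝ (Fin d)) (z : ℕ → ℝ) (t : ℕ) :
    Set (EuclideanSpace ℝ (Fin d)) :=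
  P.pess x z t ∪ (Metric.closedBall 0 P.ν ∩ P.opt x z t)

/-- The maximally scaled pessimistic set. -/
def pessBar (P : Input d) (x : ℕ → EuclideanSpace ℝ (Fin d)) (z : ℕ → ℝ) (t : ℕ) :
    Set (EuclideanSpace ℝ (Fin d)) :=
  maxScaled (P.pessHat x z t)

/-- The largest scaling `α_t(v)` that keeps `v` in the optimistic set. -/
def α (P : Input d) (x : ℕ → EuclideanSpace ℝ (Fin d)) (z : ℕ → ℝ) (t : ℕ)
    (v : EuclideanSpace ℝ (Fin d)) : ℝ :=
  sSup {m : ℝ | 0 ≤ m ∧ m • v ∈ P.opt x z t}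

/-- The adaptive exploration coefficient `κ_t(v)`. -/
def κ (P : Input d) (x : ℕ → EuclideanSpace ℝ (Fin d)) (y z : ℕ → ℝ) (t : ℕ)
    (v : EuclideanSpace ℝ (Fin d)) : ℝ :=
  (P.α x z t v - 1) * (inner ℝ (P.est x y t) v / P.width x t v) + P.α x z t v

/-- The coefficient `min (κ_t(v), 1 + 2 Sθ / b)` of C-ROFUL. -/
def κTilde (P : Input d) (x : ℕ → EuclideanSpace ℝ (Fin d)) (y z : ℕ → ℝ) (t : ℕ)
    (v : EuclideanSpace ℝ (Fin d)) : ℝ :=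
  min (P.κ x y z t v) (1 + 2 * P.Sθ / P.b)

/-- The actions from which C-ROFUL chooses in round `t`. -/
def crofulActions (P : Input d) (x : ℕ → EuclideanSpace ℝ (Fin d)) (y z : ℕ → ℝ) (t : ℕ) :
    Set (EuclideanSpace ℝ (Fin d)) :=
  argmaxOn (fun v => inner ℝ (P.est x y t) v + P.κTilde x y z t v * P.width x t v)
    (P.pessBar x z t)

end Input

/-- The observation `vᵀ x_t + ξ_t` of the unknown vector `v` under the noise `ξ`. -/
def obs {Ω : Type*} (v : EuclideanSpace ℝ (Fin d)) (x : ℕ → Ω → EuclideanSpace ℝ (Fin d))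
    (ξ : ℕ → Ω → ℝ) (ω : Ω) (t : ℕ) : ℝ :=
  inner ℝ v (x t ω) + ξ t ω

/-- The σ-algebra generated by `x_1, ξ_1, …, x_{t-1}, ξ_{t-1}, x_t`. -/
@[reducible] def history {Ω : Type*} (x : ℕ → Ω → EuclideanSpace ℝ (Fin d)) (ξ : ℕ → Ω → ℝ) (t : ℕ) :
    MeasurableSpace Ω :=
  (⨆ k ∈ Finset.Icc 1 t, MeasurableSpace.comap (x k) inferInstance) ⊔
    (⨆ k ∈ Finset.Ico 1 t, MeasurableSpace.comap (ξ k) inferInstance)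

/-- In each of the rounds `1, …, T` the noise has conditional mean zero and is conditionally
`ρ`-subgaussian, given the history up to the choice of the action of that round. -/
def CondSubgaussianNoise {Ω : Type*} [MeasurableSpace Ω] (μ : Measure Ω)
    (x : ℕ → Ω → EuclideanSpace ℝ (Fin d)) (ξ : ℕ → Ω → ℝ) (ρ : ℝ) (T : ℕ) : Prop :=
  ∀ t ∈ Finset.Icc 1 T,
    Measurable (ξ t) ∧ Integrable (ξ t) μ ∧ μ[ξ t | history x ξ t] =ᵐ[μ] 0 ∧
    ∀ s : ℝ, Integrable (fun ω => Real.exp (s * ξ t ω)) μ ∧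
      μ[fun ω => Real.exp (s * ξ t ω) | history x ξ t]
        ≤ᵐ[μ] fun _ => Real.exp (s ^ 2 * ρ ^ 2 / 2)

/-- `x` is a run of C-ROFUL over `T` rounds on the bandit with reward vector `θ`, constraint vector
`a` and noises `ε`, `η`: every action lies in the action set and is a maximizer of the C-ROFUL
objective over the maximally scaled pessimistic set. Only if there is no maximizer is the choice
of the action left free. -/
def IsCROFULRun {Ω : Type*} (P : Input d) (θ a : EuclideanSpace ℝ (Fin d))
    (x : ℕ → Ω → EuclideanSpace ℝ (Fin d)) (ε η : ℕ → Ω → ℝ) (T : ℕ) : Prop :=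
  ∀ ω, ∀ t ∈ Finset.Icc 1 T, x t ω ∈ P.X ∧
    ((P.crofulActions (fun k => x k ω) (obs θ x ε ω) (obs a x η ω) t).Nonempty →
      x t ω ∈ P.crofulActions (fun k => x k ω) (obs θ x ε ω) (obs a x η ω) t)

/-- The constrained pseudo-regret with respect to the action `xstar`. -/
def regret {Ω : Type*} (θ xstar : EuclideanSpace ℝ (Fin d))
    (x : ℕ → Ω → EuclideanSpace ℝ (Fin d)) (T : ℕ) (ω : Ω) : ℝ :=
  ∑ t ∈ Finset.Icc 1 T, inner ℝ θ (xstar - x t ω)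

end SafeLinearBandit

end

/-! Write W_t(v) = β_t‖v‖_{V_t⁻¹}. Outside an event of probability at most δ (δ/2 for each noise),
both estimates err by at most W_t(v) in every direction v and every round t ≤ T. What remains is
deterministic.

Optimism. The objective is min(α_t(v)(θ̂_tᵀv + W_t(v)), θ̂_tᵀv + (1 + 2S_θ/b)W_t(v)), see
`Input.objective_eq`. Let γ be the largest scaling that keeps γx_* in the enlarged pessimistic set.
Since x_* is optimistically feasible, α_t(γx_*) ≥ 1/γ, so the first entry at γx_* is at least θᵀx_*.
If γ < 1, maximality of γ gives (1 - γ)b ≤ 2W_t(γx_*), so the loss (1 - γ)θᵀx_* is at most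
(2S_θ/b)W_t(γx_*), which the second entry pays for. Hence a maximizer v satisfies θᵀx_* ≤ θ̂_tᵀv +
(1 + 2S_θ/b)W_t(v) ≤ θᵀv + 2(1 + S_θ/b)W_t(v). Monotonicity of β, Cauchy-Schwarz and the elliptic
potential lemma (`Input.sum_sq_wnorm_le`) sum this over the rounds. Since the action is arbitrary
when no maximizer exists, existence has to be proved: `Input.IsGoodRound.nonempty_crofulActions`.

Confidence. The method of mixtures is run one round at a time: each multiplicative increment of
`Input.mixture` is a one-dimensional Gaussian mixture of exp(g e - g²/2), so the supermartingale
step needs only a scalar integral (`CondSubgaussian.lintegral_mul_mixture_le`). Ville's inequality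
and a determinant bound finish (`Input.measure_exists_lt_noiseSum_le`). -/

open scoped ENNReal NNReal Matrix

/-! ### Quadratic forms, determinants and rank-one updates of positive definite matrices. -/

namespace Matrix

variable {n : Type*} [Fintype n]

theorem IsHermitian.dotProduct_mulVec_comm {M : Matrix n n ℝ} (hM : M.IsHermitian) (u v : n → ℝ) :
    u ⬝ᵥ M *ᵥ v = v ⬝ᵥ M *ᵥ u := by
  have h : Mᵀ = M := by simpa [conjTranspose_eq_transpose_of_trivial] using hM.eq
  rw [dotProduct_mulVec, ← mulVec_transpose, h, dotProduct_comm]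

theorem PosSemidef.dotProduct_mulVec_self_nonneg {M : Matrix n n ℝ} (hM : M.PosSemidef)
    (u : n → ℝ) : 0 ≤ u ⬝ᵥ M *ᵥ u := by
  simpa using hM.dotProduct_mulVec_nonneg u

/-- The quadratic polynomial t ↦ (u + tv)ᵀM(u + tv) is nonnegative, so its discriminant is not
positive. -/
theorem PosSemidef.sq_dotProduct_mulVec_le {M : Matrix n n ℝ} (hM : M.PosSemidef) (u v : n → ℝ) :
    (u ⬝ᵥ M *ᵥ v) ^ 2 ≤ (u ⬝ᵥ M *ᵥ u) * (v ⬝ᵥ M *ᵥ v) := by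
  have h : ∀ t : ℝ, 0 ≤ (v ⬝ᵥ M *ᵥ v) * (t * t) + (2 * (u ⬝ᵥ M *ᵥ v)) * t + u ⬝ᵥ M *ᵥ u := by
    intro t
    have := hM.dotProduct_mulVec_self_nonneg (u + t • v)
    simp only [mulVec_add, mulVec_smul, add_dotProduct, dotProduct_add, smul_dotProduct,
      dotProduct_smul, smul_eq_mul] at this
    rw [hM.isHermitian.dotProduct_mulVec_comm v u] at this
    linarith
  have := discrim_le_zero h
  unfold discrim at this
  nlinarith

theorem PosSemidef.abs_dotProduct_mulVec_le {M : Matrix n n ℝ} (hM : M.PosSemidef) (u v : n → ℝ) :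
    |u ⬝ᵥ M *ᵥ v| ≤ √(u ⬝ᵥ M *ᵥ u) * √(v ⬝ᵥ M *ᵥ v) := by
  rw [← Real.sqrt_mul (hM.dotProduct_mulVec_self_nonneg u)]
  exact Real.abs_le_sqrt (hM.sq_dotProduct_mulVec_le u v)

theorem PosDef.add_vecMulVec_self {M : Matrix n n ℝ} (hM : M.PosDef) (x : n → ℝ) :
    (M + vecMulVec x x).PosDef :=
  hM.add_posSemidef (by simpa using posSemidef_vecMulVec_self_star x)

variable [DecidableEq n]

theorem PosDef.mul_inv_cancel_real {M : Matrix n n ℝ} (hM : M.PosDef) : M * M⁻¹ = 1 :=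
  mul_nonsing_inv _ hM.det_pos.ne'.isUnit

theorem dotProduct_self_sq_le (u v : n → ℝ) : (u ⬝ᵥ v) ^ 2 ≤ (u ⬝ᵥ u) * (v ⬝ᵥ v) := by
  simpa using (PosSemidef.one (n := n) (R := ℝ)).sq_dotProduct_mulVec_le u v

/-- If `M ≥ c` then `M⁻¹ ≤ c⁻¹`. -/
theorem PosDef.dotProduct_inv_mulVec_le {M : Matrix n n ℝ} (hM : M.PosDef) {c : ℝ} (hc : 0 < c)
    (h : ∀ u, c * (u ⬝ᵥ u) ≤ u ⬝ᵥ M *ᵥ u) (v : n → ℝ) :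
    c * (v ⬝ᵥ M⁻¹ *ᵥ v) ≤ v ⬝ᵥ v := by
  -- At u = M⁻¹v the hypothesis reads c‖M⁻¹v‖² ≤ q with q = vᵀM⁻¹v. Combined with q² ≤ ‖v‖²‖M⁻¹v‖²
  -- this gives cq² ≤ ‖v‖²q, and q cancels unless it is zero.
  have h1 := h (M⁻¹ *ᵥ v)
  rw [mulVec_mulVec, hM.mul_inv_cancel_real, one_mulVec, dotProduct_comm _ v] at h1
  have h2 := dotProduct_self_sq_le v (M⁻¹ *ᵥ v)
  have h3 := hM.inv.posSemidef.dotProduct_mulVec_self_nonneg v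
  have h4 : 0 ≤ v ⬝ᵥ v := by simpa using dotProduct_star_self_nonneg v
  set q := v ⬝ᵥ M⁻¹ *ᵥ v
  rcases h3.eq_or_lt with h0 | h0
  · rw [← h0]; simpa using h4
  · have : c * q * q ≤ (v ⬝ᵥ v) * q := by
      calc c * q * q = c * q ^ 2 := by ring
        _ ≤ c * ((v ⬝ᵥ v) * (M⁻¹ *ᵥ v ⬝ᵥ M⁻¹ *ᵥ v)) := by gcongr
        _ = (v ⬝ᵥ v) * (c * (M⁻¹ *ᵥ v ⬝ᵥ M⁻¹ *ᵥ v)) := by ring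
        _ ≤ _ := by gcongr
    exact le_of_mul_le_mul_right this h0

/-- The matrix determinant lemma, whose remaining determinant is 1×1. It makes log det V_t telescope
and supplies the normalization of the mixture. -/
theorem PosDef.det_add_vecMulVec_self {M : Matrix n n ℝ} (hM : M.PosDef) (x : n → ℝ) :
    (M + vecMulVec x x).det = M.det * (1 + x ⬝ᵥ M⁻¹ *ᵥ x) := by
  have := det_add_replicateCol_mul_replicateRow (ι := Unit) hM.det_pos.ne'.isUnit x x
  rw [vecMulVec_eq Unit, this]
  congr 1
  have h : replicateRow Unit x * M⁻¹ * replicateCol Unit x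
      = diagonal fun _ : Unit => x ⬝ᵥ M⁻¹ *ᵥ x := by
    ext i j
    rw [Matrix.mul_assoc, ← replicateCol_mulVec]
    simp [Matrix.mul_apply, dotProduct]
  rw [h, ← diagonal_one, diagonal_add, det_diagonal]
  simp

/-- The quadratic form of the inverse of a rank-one update (Sherman-Morrison). -/
theorem PosDef.dotProduct_inv_add_vecMulVec_mulVec {M : Matrix n n ℝ} (hM : M.PosDef)
    (x s : n → ℝ) (e : ℝ) :
    (s + e • x) ⬝ᵥ (M + vecMulVec x x)⁻¹ *ᵥ (s + e • x) =
      s ⬝ᵥ M⁻¹ *ᵥ s + (e ^ 2 * (x ⬝ᵥ M⁻¹ *ᵥ x) + 2 * e * (s ⬝ᵥ M⁻¹ *ᵥ x)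
        - (s ⬝ᵥ M⁻¹ *ᵥ x) ^ 2) / (1 + x ⬝ᵥ M⁻¹ *ᵥ x) := by
  set w := x ⬝ᵥ M⁻¹ *ᵥ x with hw
  set m := s ⬝ᵥ M⁻¹ *ᵥ x with hm
  have hw0 : 0 ≤ w := hM.inv.posSemidef.dotProduct_mulVec_self_nonneg x
  have hm' : x ⬝ᵥ M⁻¹ *ᵥ s = m := hM.inv.isHermitian.dotProduct_mulVec_comm _ _
  have hne : 1 + w ≠ 0 := by positivity
  -- The solution of the updated linear system is guessed and verified by multiplying back.
  have key : (M + vecMulVec x x)⁻¹ *ᵥ (s + e • x)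
      = M⁻¹ *ᵥ s + ((e - m) / (1 + w)) • M⁻¹ *ᵥ x := by
    have hu : IsUnit (M + vecMulVec x x).det := (hM.add_vecMulVec_self x).det_pos.ne'.isUnit
    have : (M + vecMulVec x x) *ᵥ (M⁻¹ *ᵥ s + ((e - m) / (1 + w)) • M⁻¹ *ᵥ x) = s + e • x := by
      have hMi : ∀ u, M *ᵥ M⁻¹ *ᵥ u = u := fun u => by
        rw [mulVec_mulVec, hM.mul_inv_cancel_real, one_mulVec]
      rw [mulVec_add, mulVec_smul, add_mulVec, add_mulVec, hMi, hMi, vecMulVec_mulVec,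
        vecMulVec_mulVec, hm', ← hw]
      ext i
      simp
      field_simp
      ring
    rw [← this, mulVec_mulVec, nonsing_inv_mul _ hu, one_mulVec]
  rw [key]
  simp only [add_dotProduct, dotProduct_add, smul_dotProduct, dotProduct_smul, smul_eq_mul]
  rw [hm', ← hw, ← hm]
  field_simp
  ring

/-- The arithmetic-geometric mean inequality for the eigenvalues. -/
theorem PosDef.det_le_trace_div_card_pow {M : Matrix n n ℝ} (hM : M.PosDef) [Nonempty n] :
    M.det ≤ (M.trace / Fintype.card n) ^ Fintype.card n := by
  have hc : (0 : ℝ) < Fintype.card n := by exact_mod_cast Fintype.card_pos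
  have h := Real.geom_mean_le_arith_mean Finset.univ (fun _ : n => (1 : ℝ))
    hM.isHermitian.eigenvalues (by simp) (by simpa using hc)
    (fun i _ => (hM.eigenvalues_pos i).le)
  have hd : M.det = ∏ i, hM.isHermitian.eigenvalues i := by
    simpa using hM.isHermitian.det_eq_prod_eigenvalues
  have ht : M.trace = ∑ i, hM.isHermitian.eigenvalues i := by
    simpa using hM.isHermitian.trace_eq_sum_eigenvalues
  simp only [Real.rpow_one, one_mul, Finset.sum_const, Finset.card_univ, nsmul_eq_mul, mul_one]
    at h
  rw [← hd, ← ht] at h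
  calc M.det = (M.det ^ ((Fintype.card n : ℝ)⁻¹)) ^ Fintype.card n := by
        rw [← Real.rpow_natCast, ← Real.rpow_mul hM.det_pos.le, inv_mul_cancel₀ hc.ne',
          Real.rpow_one]
    _ ≤ _ := by
        gcongr
        exact Real.rpow_nonneg hM.det_pos.le _

end Matrix

/-! ### Conditional subgaussianity, Gaussian mixtures and Ville's inequality. -/

section Supermartingale

open ProbabilityTheory
open scoped ENNReal NNReal

variable {Ω : Type*} {m m0 : MeasurableSpace Ω} {μ : Measure Ω}

/-- The bound on the conditional expectation says that, restricted to `m`, the measure with density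
`f` is at most `c` times `μ`. Comparing measures lets `h` be any `m`-measurable weight, without
integrability. -/
theorem lintegral_mul_ofReal_le_of_condExp_le [IsFiniteMeasure μ] (hm : m ≤ m0) {f : Ω → ℝ}
    (hf0 : ∀ ω, 0 ≤ f ω) (hfm : Measurable f) (hf : Integrable f μ) {c : ℝ}
    (hle : μ[f|m] ≤ᵐ[μ] fun _ => c) {h : Ω → ℝ≥0∞} (hh : Measurable[m] h) :
    ∫⁻ ω, h ω * ENNReal.ofReal (f ω) ∂μ ≤ ENNReal.ofReal c * ∫⁻ ω, h ω ∂μ := by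
  have hle' : (μ.withDensity fun ω => ENNReal.ofReal (f ω)).trim hm
      ≤ ENNReal.ofReal c • μ.trim hm := by
    rw [Measure.le_iff]
    intro s hs
    rw [trim_measurableSet_eq hm hs, Measure.smul_apply, trim_measurableSet_eq hm hs,
      withDensity_apply _ (hm s hs), smul_eq_mul,
      ← ofReal_integral_eq_lintegral_ofReal hf.restrict (ae_of_all _ hf0),
      ← setIntegral_condExp hm hf hs]
    calc ENNReal.ofReal (∫ ω in s, (μ[f|m]) ω ∂μ)
        ≤ ENNReal.ofReal (∫ ω in s, c ∂μ) := by
          refine ENNReal.ofReal_le_ofReal ?_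
          exact integral_mono_ae integrable_condExp.restrict (integrable_const c)
            (ae_restrict_of_ae hle)
      _ = ENNReal.ofReal (c * μ.real s) := by simp [mul_comm]
      _ = ENNReal.ofReal c * μ s := by
          rw [ENNReal.ofReal_mul' measureReal_nonneg, ofReal_measureReal]
  have hh0 : Measurable h := hh.mono hm le_rfl
  calc ∫⁻ ω, h ω * ENNReal.ofReal (f ω) ∂μ
      = ∫⁻ ω, h ω ∂(μ.withDensity fun ω => ENNReal.ofReal (f ω)) := by
        rw [lintegral_withDensity_eq_lintegral_mul _ hfm.ennreal_ofReal hh0]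
        simp [mul_comm]
    _ = ∫⁻ ω, h ω ∂((μ.withDensity fun ω => ENNReal.ofReal (f ω)).trim hm) :=
        (lintegral_trim hm hh).symm
    _ ≤ ∫⁻ ω, h ω ∂(ENNReal.ofReal c • μ.trim hm) := lintegral_mono' hle' le_rfl
    _ = _ := by rw [lintegral_smul_measure, lintegral_trim hm hh, smul_eq_mul]

/-- Conditional `1`-subgaussianity, without the condition on the mean. -/
def CondSubgaussian (μ : Measure Ω) (m : MeasurableSpace Ω) (e : Ω → ℝ) : Prop :=
  Measurable[m0] e ∧ ∀ s : ℝ, Integrable (fun ω => Real.exp (s * e ω)) μ ∧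
    μ[fun ω => Real.exp (s * e ω) | m] ≤ᵐ[μ] fun _ => Real.exp (s ^ 2 / 2)

theorem CondSubgaussian.lintegral_mul_exp_le [IsFiniteMeasure μ] (hm : m ≤ m0) {e : Ω → ℝ}
    (he : CondSubgaussian μ m e) (s : ℝ) {h : Ω → ℝ≥0∞} (hh : Measurable[m] h) :
    ∫⁻ ω, h ω * ENNReal.ofReal (Real.exp (s * e ω - s ^ 2 / 2)) ∂μ ≤ ∫⁻ ω, h ω ∂μ := by
  have hem := he.1
  have h1 := lintegral_mul_ofReal_le_of_condExp_le hm (fun ω => (Real.exp_pos _).le)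
    (by fun_prop) (he.2 s).1 (he.2 s).2 (hh.const_mul (ENNReal.ofReal (Real.exp (-(s ^ 2 / 2)))))
  have h2 : ∀ ω, ENNReal.ofReal (Real.exp (-(s ^ 2 / 2))) * h ω
      * ENNReal.ofReal (Real.exp (s * e ω))
      = h ω * ENNReal.ofReal (Real.exp (s * e ω - s ^ 2 / 2)) := by
    intro ω
    rw [sub_eq_add_neg, Real.exp_add, ENNReal.ofReal_mul (Real.exp_pos _).le]
    ring
  simp only [h2] at h1
  refine h1.trans_eq ?_
  rw [lintegral_const_mul _ (hh.mono hm le_rfl), ← mul_assoc,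
    ← ENNReal.ofReal_mul (Real.exp_pos _).le, ← Real.exp_add]
  simp

/-- Completing the square in `g`: prior times likelihood is evidence times the posterior Gaussian.
The evidence is the increment of the mixture process. -/
theorem gaussianPDFReal_mul_exp (a : ℝ) {w : ℝ≥0} (hw : w ≠ 0) (e g : ℝ) :
    gaussianPDFReal a w g * Real.exp (g * e - g ^ 2 / 2) =
      Real.exp ((e ^ 2 * w + 2 * e * a - a ^ 2) / (1 + w) / 2) / √(1 + w)
        * gaussianPDFReal ((e * w + a) / (1 + w)) (w / (1 + w)) g := by
  have hw' : (w : ℝ) ≠ 0 := by exact_mod_cast hw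
  have hw0 : (0 : ℝ) < w := by positivity
  simp only [gaussianPDFReal, NNReal.coe_div, NNReal.coe_add, NNReal.coe_one]
  have hs : √(2 * Real.pi * (w / (1 + w))) = √(2 * Real.pi * w) / √(1 + w) := by
    rw [← mul_div_assoc, Real.sqrt_div' _ (by positivity)]
  have h1 : √(1 + (w : ℝ)) ≠ 0 := by positivity
  have h2 : √(2 * Real.pi * w) ≠ 0 := by positivity
  rw [hs, mul_assoc, ← Real.exp_add]
  have he : -(g - a) ^ 2 / (2 * (w : ℝ)) + (g * e - g ^ 2 / 2)
      = (e ^ 2 * w + 2 * e * a - a ^ 2) / (1 + w) / 2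
        + -(g - (e * w + a) / (1 + w)) ^ 2 / (2 * (w / (1 + w))) := by
    field_simp
    ring
  rw [he, Real.exp_add]
  field_simp

theorem lintegral_gaussianPDFReal_mul_exp (a : ℝ) {w : ℝ≥0} (hw : w ≠ 0) (e : ℝ) :
    ∫⁻ g, ENNReal.ofReal (gaussianPDFReal a w g) * ENNReal.ofReal (Real.exp (g * e - g ^ 2 / 2))
      = ENNReal.ofReal (Real.exp ((e ^ 2 * w + 2 * e * a - a ^ 2) / (1 + w) / 2) / √(1 + w)) := by
  have : ∀ g, ENNReal.ofReal (gaussianPDFReal a w g)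
      * ENNReal.ofReal (Real.exp (g * e - g ^ 2 / 2))
      = ENNReal.ofReal (Real.exp ((e ^ 2 * w + 2 * e * a - a ^ 2) / (1 + w) / 2) / √(1 + w))
        * ENNReal.ofReal (gaussianPDFReal ((e * w + a) / (1 + w)) (w / (1 + w)) g) := by
    intro g
    rw [← ENNReal.ofReal_mul (gaussianPDFReal_nonneg _ _ _), gaussianPDFReal_mul_exp a hw,
      ENNReal.ofReal_mul (by positivity)]
  simp only [this]
  rw [lintegral_const_mul _ (measurable_gaussianPDFReal _ _).ennreal_ofReal,
    lintegral_gaussianPDFReal_eq_one _ (by positivity), mul_one]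

/-- The Gaussian mixture of the exponential supermartingale increments is a supermartingale
increment. -/
theorem CondSubgaussian.lintegral_mul_mixture_le [IsFiniteMeasure μ] (hm : m ≤ m0) {e : Ω → ℝ}
    (he : CondSubgaussian μ m e) {a : Ω → ℝ} {w : Ω → ℝ≥0} (ha : Measurable[m] a)
    (hw : Measurable[m] w) (haw : ∀ ω, w ω = 0 → a ω = 0) {h : Ω → ℝ≥0∞} (hh : Measurable[m] h) :
    ∫⁻ ω, h ω * ENNReal.ofReal (Real.exp ((e ω ^ 2 * w ω + 2 * e ω * a ω - a ω ^ 2)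
      / (1 + w ω) / 2) / √(1 + w ω)) ∂μ ≤ ∫⁻ ω, h ω ∂μ := by
  have hem := he.1
  have ha0 : Measurable a := ha.mono hm le_rfl
  have hw0 : Measurable w := hw.mono hm le_rfl
  have hh0 : Measurable h := hh.mono hm le_rfl
  have hZ : MeasurableSet[m] {ω | w ω = 0} := hw (measurableSet_singleton 0)
  have hpdf : Measurable fun p : Ω × ℝ => gaussianPDFReal (a p.1) (w p.1) p.2 :=
    measurable_uncurry_gaussianPDFReal.comp
      ((ha0.comp measurable_fst).prodMk ((hw0.comp measurable_fst).prodMk measurable_snd))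
  have hpdf_m : ∀ g, Measurable[m] fun ω => gaussianPDFReal (a ω) (w ω) g := fun g =>
    measurable_uncurry_gaussianPDFReal.comp (ha.prodMk (hw.prodMk measurable_const))
  -- Where w = 0 the Gaussian density is identically zero instead of representing a point mass.
  -- There a = 0 as well, so the increment is 1 and `h` itself is added back through the indicator.
  have hpt : ∀ ω, h ω * ENNReal.ofReal (Real.exp ((e ω ^ 2 * w ω + 2 * e ω * a ω - a ω ^ 2)
      / (1 + w ω) / 2) / √(1 + w ω)) = {ω | w ω = 0}.indicator h ω
        + ∫⁻ g, h ω * ENNReal.ofReal (gaussianPDFReal (a ω) (w ω) g)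
          * ENNReal.ofReal (Real.exp (g * e ω - g ^ 2 / 2)) := by
    intro ω
    by_cases h0 : w ω = 0
    · simp [h0, haw ω h0]
    · have hmeas : Measurable fun g => ENNReal.ofReal (gaussianPDFReal (a ω) (w ω) g)
          * ENNReal.ofReal (Real.exp (g * e ω - g ^ 2 / 2)) :=
        (measurable_gaussianPDFReal _ _).ennreal_ofReal.mul (by fun_prop)
      simp only [mul_assoc]
      rw [lintegral_const_mul _ hmeas, lintegral_gaussianPDFReal_mul_exp _ h0]
      simp [h0, mul_assoc]
  have hpt' : ∀ ω, h ω = {ω | w ω = 0}.indicator h ω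
        + ∫⁻ g, h ω * ENNReal.ofReal (gaussianPDFReal (a ω) (w ω) g) := by
    intro ω
    rw [lintegral_const_mul _ (measurable_gaussianPDFReal _ _).ennreal_ofReal]
    by_cases h0 : w ω = 0
    · simp [h0]
    · rw [lintegral_gaussianPDFReal_eq_one _ h0]
      simp [h0]
  have hind : Measurable ({ω | w ω = 0}.indicator h) := hh0.indicator (hm _ hZ)
  calc _ = ∫⁻ ω, ({ω | w ω = 0}.indicator h ω
        + ∫⁻ g, h ω * ENNReal.ofReal (gaussianPDFReal (a ω) (w ω) g)
          * ENNReal.ofReal (Real.exp (g * e ω - g ^ 2 / 2))) ∂μ := by simp only [hpt]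
    _ = ∫⁻ ω, {ω | w ω = 0}.indicator h ω ∂μ
        + ∫⁻ g, ∫⁻ ω, h ω * ENNReal.ofReal (gaussianPDFReal (a ω) (w ω) g)
          * ENNReal.ofReal (Real.exp (g * e ω - g ^ 2 / 2)) ∂μ := by
        rw [lintegral_add_left hind, lintegral_lintegral_swap]
        refine Measurable.aemeasurable (Measurable.mul (Measurable.mul ?_ ?_) ?_)
        · exact hh0.comp measurable_fst
        · exact hpdf.ennreal_ofReal
        · fun_prop
    _ ≤ ∫⁻ ω, {ω | w ω = 0}.indicator h ω ∂μ
        + ∫⁻ g, ∫⁻ ω, h ω * ENNReal.ofReal (gaussianPDFReal (a ω) (w ω) g) ∂μ := by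
        -- After Tonelli `g` is fixed, and the density at `g` is `m`-measurable in ω, so it joins
        -- the weight in the subgaussian bound.
        gcongr ∫⁻ ω, _ ∂μ + ?_
        refine lintegral_mono fun g => ?_
        have := he.lintegral_mul_exp_le hm g (hh.mul (hpdf_m g).ennreal_ofReal)
        simpa only [Pi.mul_apply] using this
    _ = ∫⁻ ω, ({ω | w ω = 0}.indicator h ω
        + ∫⁻ g, h ω * ENNReal.ofReal (gaussianPDFReal (a ω) (w ω) g)) ∂μ := by
        rw [lintegral_add_left hind, lintegral_lintegral_swap]
        refine Measurable.aemeasurable (Measurable.mul ?_ ?_)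
        · exact hh0.comp measurable_snd
        · exact (hpdf.comp measurable_swap).ennreal_ofReal
    _ = _ := by simp only [← hpt']

/-- Ville's inequality on a finite horizon: a nonnegative process, started at `1`, that does not
increase in expectation on the past events exceeds `1 / δ` with probability at most `δ`. -/
theorem measure_exists_le_of_supermartingale [IsProbabilityMeasure μ] {T : ℕ}
    (F : ℕ → MeasurableSpace Ω) (hF : ∀ s t, s ≤ t → F s ≤ F t)
    (hF0 : ∀ t, 1 ≤ t → t ≤ T → F t ≤ m0) (M : ℕ → Ω → ℝ≥0∞) (hM1 : ∀ ω, M 1 ω = 1)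
    (hM : ∀ t, 1 ≤ t → t ≤ T → Measurable[F t] (M t))
    (hstep : ∀ t, 1 ≤ t → t < T → ∀ A, MeasurableSet[F t] A →
      ∫⁻ ω in A, M (t + 1) ω ∂μ ≤ ∫⁻ ω in A, M t ω ∂μ) (c : ℝ≥0∞) :
    c * μ {ω | ∃ t, 1 ≤ t ∧ t ≤ T ∧ c ≤ M t ω} ≤ 1 := by
  set B : ℕ → Set Ω := fun t => {ω | ∃ s, 1 ≤ s ∧ s ≤ t ∧ c ≤ M s ω} with hB
  have hBm : ∀ t, t ≤ T → MeasurableSet[F t] (B t) := by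
    intro t ht
    have : B t = ⋃ s ∈ Finset.Icc 1 t, {ω | c ≤ M s ω} := by
      ext ω; simp [hB, and_assoc]
    rw [this]
    refine Finset.measurableSet_biUnion _ fun s hs => ?_
    rw [Finset.mem_Icc] at hs
    exact hF s t hs.2 _ (hM s hs.1 (hs.2.trans ht) measurableSet_Ici)
  have hBs : ∀ t, B (t + 1) = B t ∪ {ω | c ≤ M (t + 1) ω} := by
    intro t
    ext ω
    simp only [hB, Set.mem_union, Set.mem_ofPred_eq]
    constructor
    · rintro ⟨s, h1, h2, h3⟩
      rcases Nat.lt_or_ge t s with h | h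
      · obtain rfl : s = t + 1 := by omega
        exact Or.inr h3
      · exact Or.inl ⟨s, h1, h, h3⟩
    · rintro (⟨s, h1, h2, h3⟩ | h)
      · exact ⟨s, h1, by omega, h3⟩
      · exact ⟨t + 1, by omega, le_rfl, h⟩
  have hCm : ∀ t, t + 1 ≤ T → MeasurableSet[F (t + 1)] {ω | c ≤ M (t + 1) ω} :=
    fun t ht => hM (t + 1) (by omega) ht measurableSet_Ici
  -- Paths that cross for the first time at t + 1 satisfy c ≤ M_{t+1}, so their share of M_{t+1}
  -- pays for them.
  have hsucc : ∀ t, t + 1 ≤ T → c * μ (B (t + 1))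
      ≤ c * μ (B t) + ∫⁻ ω in (B t)ᶜ ∩ {ω | c ≤ M (t + 1) ω}, M (t + 1) ω ∂μ := by
    intro t ht
    have hle := hF0 (t + 1) (by omega) (by omega)
    have hBt : MeasurableSet (B t) := hle _ (hF t (t + 1) (by omega) _ (hBm t (by omega)))
    have : B (t + 1) = B t ∪ ((B t)ᶜ ∩ {ω | c ≤ M (t + 1) ω}) := by
      rw [hBs, Set.union_inter_distrib_left]; simp
    rw [this]
    calc c * μ (B t ∪ ((B t)ᶜ ∩ {ω | c ≤ M (t + 1) ω}))
        ≤ c * (μ (B t) + μ ((B t)ᶜ ∩ {ω | c ≤ M (t + 1) ω})) := by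
          gcongr; exact measure_union_le _ _
      _ = c * μ (B t) + c * μ ((B t)ᶜ ∩ {ω | c ≤ M (t + 1) ω}) := mul_add _ _ _
      _ ≤ _ := by
          gcongr 1
          rw [← setLIntegral_const]
          exact setLIntegral_mono' (hBt.compl.inter (hle _ (hCm t ht))) fun ω hω => hω.2
  -- The invariant is the expectation of the stopped process: paths that crossed by time t count
  -- `c`, the others carry M_{t+1}. It starts at 1 because nothing has crossed at time 0 and M_1 =
  -- 1.
  have key : ∀ t, t + 1 ≤ T → ∫⁻ ω in (B t)ᶜ, M (t + 1) ω ∂μ + c * μ (B t) ≤ 1 := by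
    intro t
    induction t with
    | zero =>
      intro _
      have : B 0 = ∅ := by
        ext ω; simp only [hB, Set.mem_ofPred_eq, Set.mem_empty_iff_false, iff_false]
        rintro ⟨s, h1, h2, -⟩; omega
      simp [this, hM1]
    | succ t ih =>
      intro ht
      have hle := hF0 (t + 1) (by omega) (by omega)
      calc ∫⁻ ω in (B (t + 1))ᶜ, M (t + 1 + 1) ω ∂μ + c * μ (B (t + 1))
          ≤ ∫⁻ ω in (B (t + 1))ᶜ, M (t + 1) ω ∂μ + c * μ (B (t + 1)) := by
            gcongr 1
            exact hstep (t + 1) (by omega) (by omega) _ (hBm (t + 1) (by omega)).compl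
        _ ≤ ∫⁻ ω in (B (t + 1))ᶜ, M (t + 1) ω ∂μ
            + (c * μ (B t) + ∫⁻ ω in (B t)ᶜ ∩ {ω | c ≤ M (t + 1) ω}, M (t + 1) ω ∂μ) := by
            gcongr 1
            exact hsucc t (by omega)
        _ = (∫⁻ ω in (B t)ᶜ ∩ {ω | c ≤ M (t + 1) ω}, M (t + 1) ω ∂μ
            + ∫⁻ ω in (B t)ᶜ \ {ω | c ≤ M (t + 1) ω}, M (t + 1) ω ∂μ) + c * μ (B t) := by
            have : (B (t + 1))ᶜ = (B t)ᶜ \ {ω | c ≤ M (t + 1) ω} := by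
              rw [hBs, Set.compl_union, Set.sdiff_eq]
            rw [this]
            ring
        _ = ∫⁻ ω in (B t)ᶜ, M (t + 1) ω ∂μ + c * μ (B t) := by
            rw [lintegral_inter_add_sdiff _ _ (hle _ (hCm t (by omega)))]
        _ ≤ 1 := ih (by omega)
  rcases T with _ | T
  · simp
  · change c * μ (B (T + 1)) ≤ 1
    refine le_trans ?_ (key T le_rfl)
    refine (hsucc T le_rfl).trans ?_
    rw [add_comm _ (c * μ (B T))]
    gcongr 1
    exact lintegral_mono_set Set.inter_subset_left

end Supermartingale

/-! ### Measurability of quadratic forms, determinants and inverses. -/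

section MatrixMeasurability

variable {Ω n : Type*} [MeasurableSpace Ω] [Fintype n]

theorem Measurable.dotProduct_mulVec_of_apply {A : Ω → Matrix n n ℝ} {u v : Ω → n → ℝ}
    (hA : ∀ i j, Measurable fun ω => A ω i j) (hu : ∀ i, Measurable fun ω => u ω i)
    (hv : ∀ i, Measurable fun ω => v ω i) : Measurable fun ω => u ω ⬝ᵥ (A ω).mulVec (v ω) := by
  simp only [dotProduct, Matrix.mulVec]
  exact Finset.measurable_sum _ fun i _ => (hu i).mul
    (Finset.measurable_sum _ fun j _ => (hA i j).mul (hv j))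

variable [DecidableEq n]

theorem Measurable.matrix_det_of_apply {A : Ω → Matrix n n ℝ}
    (hA : ∀ i j, Measurable fun ω => A ω i j) : Measurable fun ω => (A ω).det := by
  simp only [Matrix.det_apply]
  refine Finset.measurable_sum _ fun σ _ => ?_
  exact (Finset.measurable_prod _ fun i _ => hA _ _).const_smul _

theorem Measurable.matrix_inv_apply_of_apply {A : Ω → Matrix n n ℝ}
    (hA : ∀ i j, Measurable fun ω => A ω i j) (i j : n) : Measurable fun ω => (A ω)⁻¹ i j := by
  simp only [Matrix.inv_def, Ring.inverse_eq_inv', Matrix.smul_apply, smul_eq_mul,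
    Matrix.adjugate_apply]
  refine (Measurable.matrix_det_of_apply hA).inv.mul (Measurable.matrix_det_of_apply fun k l => ?_)
  by_cases h : k = j
  · subst h; simp
  · simpa [Matrix.updateRow_ne h] using hA k l

end MatrixMeasurability

/-! ### The Gram matrix, the elliptic potential and the mixture process. -/

namespace SafeLinearBandit

variable {d : ℕ}

theorem dotProduct_ofLp_self (v : EuclideanSpace ℝ (Fin d)) : v.ofLp ⬝ᵥ v.ofLp = ‖v‖ ^ 2 := by
  rw [EuclideanSpace.norm_sq_eq]
  simp [dotProduct, sq]

theorem inner_eq_dotProduct_ofLp (u v : EuclideanSpace ℝ (Fin d)) :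
    inner ℝ u v = u.ofLp ⬝ᵥ v.ofLp := by
  simp [EuclideanSpace.inner_eq_star_dotProduct, dotProduct_comm]

namespace Input

theorem V_one (P : Input d) (x : ℕ → EuclideanSpace ℝ (Fin d)) : P.V x 1 = P.lam • 1 := by
  simp [V]

theorem V_succ (P : Input d) (x : ℕ → EuclideanSpace ℝ (Fin d)) {t : ℕ} (ht : 1 ≤ t) :
    P.V x (t + 1) = P.V x t + Matrix.vecMulVec (x t).ofLp (x t).ofLp := by
  rw [V, V, Finset.sum_Ico_succ_top ht]
  abel

theorem posSemidef_sum_vecMulVec (x : ℕ → EuclideanSpace ℝ (Fin d)) (t : ℕ) :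
    (∑ k ∈ Finset.Ico 1 t, Matrix.vecMulVec (x k).ofLp (x k).ofLp).PosSemidef :=
  Matrix.posSemidef_sum _ fun k _ => by
    simpa using Matrix.posSemidef_vecMulVec_self_star (x k).ofLp

theorem posDef_V (P : Input d) (hlam : 0 < P.lam) (x : ℕ → EuclideanSpace ℝ (Fin d)) (t : ℕ) :
    (P.V x t).PosDef :=
  Matrix.PosDef.posSemidef_add (posSemidef_sum_vecMulVec x t) (Matrix.PosDef.one.smul hlam)

theorem lam_mul_le_dotProduct_V (P : Input d) (x : ℕ → EuclideanSpace ℝ (Fin d)) (t : ℕ)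
    (u : Fin d → ℝ) : P.lam * (u ⬝ᵥ u) ≤ u ⬝ᵥ (P.V x t).mulVec u := by
  have := (posSemidef_sum_vecMulVec x t).dotProduct_mulVec_self_nonneg u
  rw [V, Matrix.add_mulVec, dotProduct_add, Matrix.smul_mulVec, Matrix.one_mulVec,
    dotProduct_smul, smul_eq_mul]
  linarith

theorem lam_mul_inv_V_le (P : Input d) (hlam : 0 < P.lam) (x : ℕ → EuclideanSpace ℝ (Fin d))
    (t : ℕ) (v : EuclideanSpace ℝ (Fin d)) :
    P.lam * (v.ofLp ⬝ᵥ (P.V x t)⁻¹.mulVec v.ofLp) ≤ ‖v‖ ^ 2 := by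
  rw [← dotProduct_ofLp_self]
  exact (P.posDef_V hlam x t).dotProduct_inv_mulVec_le hlam (P.lam_mul_le_dotProduct_V x t) _

theorem trace_V_le (P : Input d) {x : ℕ → EuclideanSpace ℝ (Fin d)} {t : ℕ} (ht : 1 ≤ t)
    (hx : ∀ k ∈ Finset.Ico 1 t, ‖x k‖ ≤ 1) : (P.V x t).trace ≤ ((t : ℝ) - 1) + P.lam * d := by
  rw [V, Matrix.trace_add, Matrix.trace_sum, Matrix.trace_smul, Matrix.trace_one,
    Fintype.card_fin, smul_eq_mul]
  gcongr
  calc ∑ k ∈ Finset.Ico 1 t, (Matrix.vecMulVec (x k).ofLp (x k).ofLp).trace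
      ≤ ∑ k ∈ Finset.Ico 1 t, (1 : ℝ) := by
        refine Finset.sum_le_sum fun k hk => ?_
        rw [Matrix.trace_vecMulVec, dotProduct_ofLp_self]
        exact pow_le_one₀ (norm_nonneg _) (hx k hk)
    _ = (t : ℝ) - 1 := by simp [Nat.cast_sub ht]

theorem det_V_div_le (P : Input d) (hd : 1 ≤ d) (hlam : 0 < P.lam)
    {x : ℕ → EuclideanSpace ℝ (Fin d)} {t : ℕ} (ht : 1 ≤ t)
    (hx : ∀ k ∈ Finset.Ico 1 t, ‖x k‖ ≤ 1) :
    (P.V x t).det / P.lam ^ d ≤ (1 + ((t : ℝ) - 1) / (P.lam * d)) ^ d := by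
  have : Nonempty (Fin d) := ⟨⟨0, hd⟩⟩
  have hd0 : (0 : ℝ) < d := by exact_mod_cast hd
  have h := (P.posDef_V hlam x t).det_le_trace_div_card_pow
  rw [Fintype.card_fin] at h
  rw [div_le_iff₀ (by positivity), ← mul_pow]
  refine h.trans ?_
  have h0 : 0 ≤ (P.V x t).trace := (P.posDef_V hlam x t).posSemidef.trace_nonneg
  refine pow_le_pow_left₀ (by positivity) ?_ d
  rw [div_le_iff₀ hd0]
  refine (P.trace_V_le ht hx).trans_eq ?_
  field_simp
  ring

theorem log_det_V_div_le (P : Input d) (hd : 1 ≤ d) (hlam : 0 < P.lam)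
    {x : ℕ → EuclideanSpace ℝ (Fin d)} {t : ℕ} (ht : 1 ≤ t)
    (hx : ∀ k ∈ Finset.Ico 1 t, ‖x k‖ ≤ 1) :
    Real.log ((P.V x t).det / P.lam ^ d) ≤ d * Real.log (1 + ((t : ℝ) - 1) / (P.lam * d)) := by
  rw [← Real.log_pow]
  exact Real.log_le_log (div_pos (P.posDef_V hlam x t).det_pos (by positivity))
    (P.det_V_div_le hd hlam ht hx)

theorem sq_wnorm_inv_V (P : Input d) (hlam : 0 < P.lam) (x : ℕ → EuclideanSpace ℝ (Fin d)) (t : ℕ)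
    (v : EuclideanSpace ℝ (Fin d)) :
    wnorm (P.V x t)⁻¹ v ^ 2 = v.ofLp ⬝ᵥ (P.V x t)⁻¹.mulVec v.ofLp :=
  Real.sq_sqrt ((P.posDef_V hlam x t).inv.posSemidef.dotProduct_mulVec_self_nonneg _)

/-- The elliptic potential lemma. -/
theorem sum_sq_wnorm_le (P : Input d) (hd : 1 ≤ d) (hlam : 1 ≤ P.lam)
    {x : ℕ → EuclideanSpace ℝ (Fin d)} {T : ℕ} (hx : ∀ k ∈ Finset.Icc 1 T, ‖x k‖ ≤ 1) :
    ∑ t ∈ Finset.Icc 1 T, wnorm (P.V x t)⁻¹ (x t) ^ 2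
      ≤ 2 * d * Real.log (1 + T / (P.lam * d)) := by
  have hlam0 : 0 < P.lam := by linarith
  have hle : ∀ T : ℕ, (∀ k ∈ Finset.Icc 1 T, ‖x k‖ ≤ 1) →
      ∑ t ∈ Finset.Icc 1 T, wnorm (P.V x t)⁻¹ (x t) ^ 2
        ≤ 2 * Real.log ((P.V x (T + 1)).det / P.lam ^ d) := by
    intro T
    induction T with
    | zero =>
      intro _
      simp [V_one, div_self (pow_pos hlam0 d).ne']
    | succ T ih =>
      intro hx
      have hV := P.posDef_V hlam0 x (T + 1)
      have hx1 := hx (T + 1) (by simp)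
      have h1 := ih fun k hk => hx k (by simp only [Finset.mem_Icc] at hk ⊢; omega)
      rw [Finset.sum_Icc_succ_top (by omega), P.V_succ x (t := T + 1) (by omega),
        hV.det_add_vecMulVec_self, ← P.sq_wnorm_inv_V hlam0]
      -- Here λ ≥ 1 is needed: w ≤ ‖x‖²/λ ≤ 1, and in this range w ≤ 2 log(1 + w).
      have hw1 : wnorm (P.V x (T + 1))⁻¹ (x (T + 1)) ^ 2 ≤ 1 := by
        have h2 := P.lam_mul_inv_V_le hlam0 x (T + 1) (x (T + 1))
        rw [← P.sq_wnorm_inv_V hlam0] at h2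
        have h3 : ‖x (T + 1)‖ ^ 2 ≤ 1 := pow_le_one₀ (norm_nonneg _) hx1
        nlinarith [sq_nonneg (wnorm (P.V x (T + 1))⁻¹ (x (T + 1)))]
      set w := wnorm (P.V x (T + 1))⁻¹ (x (T + 1)) ^ 2 with hw
      have hw0 : 0 ≤ w := sq_nonneg _
      rw [mul_div_right_comm, Real.log_mul (div_pos hV.det_pos (by positivity)).ne'
        (by positivity)]
      have h4 : w ≤ 2 * Real.log (1 + w) := by
        have := Real.le_log_one_add_of_nonneg hw0
        have h5 : w / 2 ≤ 2 * w / (w + 2) := by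
          rw [div_le_div_iff₀ (by norm_num) (by linarith)]
          nlinarith
        linarith
      linarith
  refine (hle T hx).trans ?_
  have := P.log_det_V_div_le hd hlam0 (x := x) (t := T + 1) (by omega) (fun k hk => hx k (by
    simp only [Finset.mem_Icc, Finset.mem_Ico] at hk ⊢; omega))
  push_cast at this
  rw [add_sub_cancel_right] at this
  linarith

/-- The noise part `∑_{k < t} e_k x_k` of the right-hand side of the normal equations. -/
def noiseSum (x : ℕ → EuclideanSpace ℝ (Fin d)) (e : ℕ → ℝ) (t : ℕ) : Fin d → ℝ :=
  ∑ k ∈ Finset.Ico 1 t, e k • (x k).ofLp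

/-- The method-of-mixtures supermartingale `exp (‖∑ e_k x_k‖²_{V_t⁻¹} / 2) / √(det V_t / λ^d)`. -/
noncomputable def mixture (P : Input d) (x : ℕ → EuclideanSpace ℝ (Fin d)) (e : ℕ → ℝ) (t : ℕ) :
    ℝ :=
  Real.exp ((noiseSum x e t ⬝ᵥ (P.V x t)⁻¹.mulVec (noiseSum x e t)) / 2)
    / √((P.V x t).det / P.lam ^ d)

theorem mixture_one (P : Input d) (hlam : 0 < P.lam) (x : ℕ → EuclideanSpace ℝ (Fin d))
    (e : ℕ → ℝ) : P.mixture x e 1 = 1 := by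
  simp [mixture, noiseSum, V_one, div_self (pow_pos hlam d).ne']

/-- Sherman-Morrison updates the exponent and the determinant lemma the denominator. The new factor
is the Gaussian mixture with variance w = xᵀV⁻¹x and mean a = sᵀV⁻¹x, where s is the noise sum; both
are known before the noise of round t. -/
theorem mixture_succ (P : Input d) (hlam : 0 < P.lam) (x : ℕ → EuclideanSpace ℝ (Fin d))
    (e : ℕ → ℝ) {t : ℕ} (ht : 1 ≤ t) :
    P.mixture x e (t + 1) = P.mixture x e t *
      (Real.exp ((e t ^ 2 * ((x t).ofLp ⬝ᵥ (P.V x t)⁻¹.mulVec (x t).ofLp)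
          + 2 * e t * (noiseSum x e t ⬝ᵥ (P.V x t)⁻¹.mulVec (x t).ofLp)
          - (noiseSum x e t ⬝ᵥ (P.V x t)⁻¹.mulVec (x t).ofLp) ^ 2)
        / (1 + (x t).ofLp ⬝ᵥ (P.V x t)⁻¹.mulVec (x t).ofLp) / 2)
        / √(1 + (x t).ofLp ⬝ᵥ (P.V x t)⁻¹.mulVec (x t).ofLp)) := by
  have hV := P.posDef_V hlam x t
  have hs : noiseSum x e (t + 1) = noiseSum x e t + e t • (x t).ofLp := by
    rw [noiseSum, noiseSum, Finset.sum_Ico_succ_top ht]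
  rw [mixture, mixture, P.V_succ x ht, hs, hV.dotProduct_inv_add_vecMulVec_mulVec,
    hV.det_add_vecMulVec_self, mul_div_right_comm,
    Real.sqrt_mul (div_pos hV.det_pos (by positivity)).le, add_div, Real.exp_add,
    mul_div_mul_comm]

section Measurability

variable {Ω : Type*} [MeasurableSpace Ω] {x : ℕ → Ω → EuclideanSpace ℝ (Fin d)} {e : ℕ → Ω → ℝ}

theorem measurable_ofLp_apply {f : Ω → EuclideanSpace ℝ (Fin d)} (hf : Measurable f) (i : Fin d) :
    Measurable fun ω => (f ω).ofLp i :=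
  (show Continuous fun v : EuclideanSpace ℝ (Fin d) => v.ofLp i by fun_prop).measurable.comp hf

theorem measurable_V_apply (P : Input d) {t : ℕ} (hx : ∀ k ∈ Finset.Ico 1 t, Measurable (x k))
    (i j : Fin d) : Measurable fun ω => P.V (fun k => x k ω) t i j := by
  simp only [V, Matrix.add_apply, Matrix.sum_apply, Matrix.vecMulVec_apply]
  exact (Finset.measurable_sum _ fun k hk => (measurable_ofLp_apply (hx k hk) i).mul
    (measurable_ofLp_apply (hx k hk) j)).add_const _

theorem measurable_noiseSum_apply {t : ℕ} (hx : ∀ k ∈ Finset.Ico 1 t, Measurable (x k))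
    (he : ∀ k ∈ Finset.Ico 1 t, Measurable (e k)) (i : Fin d) :
    Measurable fun ω => noiseSum (fun k => x k ω) (fun k => e k ω) t i := by
  simp only [noiseSum, Finset.sum_apply, Pi.smul_apply, smul_eq_mul]
  exact Finset.measurable_sum _ fun k hk => (he k hk).mul (measurable_ofLp_apply (hx k hk) i)

theorem measurable_mixture (P : Input d) {t : ℕ} (hx : ∀ k ∈ Finset.Ico 1 t, Measurable (x k))
    (he : ∀ k ∈ Finset.Ico 1 t, Measurable (e k)) :
    Measurable fun ω => P.mixture (fun k => x k ω) (fun k => e k ω) t := by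
  have hV := P.measurable_V_apply hx
  have hS := measurable_noiseSum_apply hx he
  have h1 := Measurable.dotProduct_mulVec_of_apply (Measurable.matrix_inv_apply_of_apply hV) hS hS
  have h2 := Measurable.matrix_det_of_apply hV
  exact (Real.measurable_exp.comp (h1.div_const 2)).div (h2.div_const _).sqrt

end Measurability

theorem measure_exists_le_mixture {Ω : Type*} {m0 : MeasurableSpace Ω} {μ : Measure Ω}
    [IsProbabilityMeasure μ] (P : Input d) (hlam : 0 < P.lam) {T : ℕ}
    (F : ℕ → MeasurableSpace Ω) (hF : ∀ s t, s ≤ t → F s ≤ F t)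
    (hF0 : ∀ t, 1 ≤ t → t ≤ T → F t ≤ m0)
    {x : ℕ → Ω → EuclideanSpace ℝ (Fin d)} {e : ℕ → Ω → ℝ}
    (hx : ∀ k t, 1 ≤ k → k ≤ t → t ≤ T → Measurable[F t] (x k))
    (heF : ∀ k t, 1 ≤ k → k < t → t ≤ T → Measurable[F t] (e k))
    (he : ∀ t, 1 ≤ t → t ≤ T → CondSubgaussian μ (F t) (e t)) {c : ℝ} (hc : 0 < c) :
    μ {ω | ∃ t, 1 ≤ t ∧ t ≤ T ∧ c⁻¹ ≤ P.mixture (fun k => x k ω) (fun k => e k ω) t}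
      ≤ ENNReal.ofReal c := by
  have hMm : ∀ t, 1 ≤ t → t ≤ T → Measurable[F t]
      fun ω => ENNReal.ofReal (P.mixture (fun k => x k ω) (fun k => e k ω) t) := by
    intro t h1 h2
    let _ := F t
    refine (P.measurable_mixture (fun k hk => ?_) fun k hk => ?_).ennreal_ofReal
    all_goals rw [Finset.mem_Ico] at hk
    · exact hx k t hk.1 hk.2.le h2
    · exact heF k t hk.1 hk.2 h2
  have h := measure_exists_le_of_supermartingale (μ := μ) F hF hF0
    (fun t ω => ENNReal.ofReal (P.mixture (fun k => x k ω) (fun k => e k ω) t))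
    (fun ω => by rw [P.mixture_one hlam, ENNReal.ofReal_one]) hMm ?_ (ENNReal.ofReal c⁻¹)
  · have hset : {ω | ∃ t, 1 ≤ t ∧ t ≤ T ∧ c⁻¹ ≤ P.mixture (fun k => x k ω) (fun k => e k ω) t}
        ⊆ {ω | ∃ t, 1 ≤ t ∧ t ≤ T ∧ ENNReal.ofReal c⁻¹
          ≤ ENNReal.ofReal (P.mixture (fun k => x k ω) (fun k => e k ω) t)} :=
      fun ω ⟨t, h1, h2, h3⟩ => ⟨t, h1, h2, ENNReal.ofReal_le_ofReal h3⟩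
    refine (measure_mono hset).trans ?_
    rw [ENNReal.ofReal_inv_of_pos hc] at h ⊢
    rw [mul_comm, ← div_eq_mul_inv,
      ENNReal.div_le_iff (by simpa using hc) ENNReal.ofReal_ne_top, one_mul] at h
    exact h
  · intro t h1 h2 A hA
    have hFt := hF0 t h1 h2.le
    have hxm : ∀ k ∈ Finset.Ico 1 t, Measurable[F t] (x k) := fun k hk => by
      rw [Finset.mem_Ico] at hk
      exact hx k t hk.1 hk.2.le h2.le
    have hem : ∀ k ∈ Finset.Ico 1 t, Measurable[F t] (e k) := fun k hk => by
      rw [Finset.mem_Ico] at hk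
      exact heF k t hk.1 hk.2 h2.le
    have hxt : Measurable[F t] (x t) := hx t t h1 le_rfl h2.le
    have hVi := fun i j => @Measurable.matrix_inv_apply_of_apply Ω _ (F t) _ _ _
      (@measurable_V_apply d Ω (F t) x P t hxm) i j
    have ha : Measurable[F t] fun ω => noiseSum (fun k => x k ω) (fun k => e k ω) t
        ⬝ᵥ (P.V (fun k => x k ω) t)⁻¹.mulVec (x t ω).ofLp :=
      @Measurable.dotProduct_mulVec_of_apply Ω _ (F t) _ _ _ _ hVi
        (@measurable_noiseSum_apply d Ω (F t) x e t hxm hem)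
        (@measurable_ofLp_apply d Ω (F t) (x t) hxt)
    have hw : Measurable[F t] fun ω => Real.toNNReal
        ((x t ω).ofLp ⬝ᵥ (P.V (fun k => x k ω) t)⁻¹.mulVec (x t ω).ofLp) :=
      measurable_real_toNNReal.comp (@Measurable.dotProduct_mulVec_of_apply Ω _ (F t) _ _ _ _ hVi
        (@measurable_ofLp_apply d Ω (F t) (x t) hxt) (@measurable_ofLp_apply d Ω (F t) (x t) hxt))
    have hwc : ∀ ω, 0 ≤ (x t ω).ofLp ⬝ᵥ (P.V (fun k => x k ω) t)⁻¹.mulVec (x t ω).ofLp := fun ω =>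
      (P.posDef_V hlam _ t).inv.posSemidef.dotProduct_mulVec_self_nonneg _
    have key := (he t h1 h2.le).lintegral_mul_mixture_le hFt ha hw (fun ω h0 => ?_)
      ((hMm t h1 h2.le).indicator hA)
    · rw [lintegral_indicator (hFt _ hA)] at key
      refine le_trans (le_of_eq ?_) key
      rw [← lintegral_indicator (hFt _ hA)]
      refine lintegral_congr fun ω => ?_
      by_cases hω : ω ∈ A
      · rw [Set.indicator_of_mem hω, Set.indicator_of_mem hω, P.mixture_succ hlam _ _ h1,
          ENNReal.ofReal_mul (by unfold mixture; positivity), Real.coe_toNNReal _ (hwc ω)]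
      · simp [hω]
    · have hx0 : (x t ω).ofLp = 0 := by
        by_contra hne
        have := (P.posDef_V hlam (fun k => x k ω) t).inv.dotProduct_mulVec_pos hne
        rw [Real.toNNReal_eq_zero] at h0
        simp only [star_trivial] at this
        linarith
      simp [hx0]

end Input

end SafeLinearBandit

/-! ### Action sets, optimism and the regret of one round. -/

namespace SafeLinearBandit

variable {d : ℕ}

theorem exists_isGreatest_smul_mem {D : Set (EuclideanSpace ℝ (Fin d))} (hD : IsCompact D)
    (h0 : 0 ∈ D) {u : EuclideanSpace ℝ (Fin d)} (hu : u ≠ 0) :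
    ∃ g, IsGreatest {m : ℝ | 0 ≤ m ∧ m • u ∈ D} g := by
  have hK : IsCompact {m : ℝ | 0 ≤ m ∧ m • u ∈ D} :=
    ((isClosedEmbedding_smul_left hu).isCompact_preimage hD).inter_left isClosed_Ici
  exact hK.exists_isGreatest ⟨0, le_rfl, by simpa using h0⟩

theorem smul_mem_maxScaled_of_isGreatest {D : Set (EuclideanSpace ℝ (Fin d))}
    {u : EuclideanSpace ℝ (Fin d)} {g : ℝ} (hg : IsGreatest {m : ℝ | 0 ≤ m ∧ m • u ∈ D} g)
    (hg0 : 0 < g) : g • u ∈ maxScaled D := by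
  refine ⟨hg.1.2, fun ζ hζ hmem => ?_⟩
  rw [smul_smul] at hmem
  have : ζ * g ≤ g := hg.2 ⟨by positivity, hmem⟩
  nlinarith

theorem ne_zero_of_mem_maxScaled {D : Set (EuclideanSpace ℝ (Fin d))} (h0 : 0 ∈ D)
    {v : EuclideanSpace ℝ (Fin d)} (hv : v ∈ maxScaled D) : v ≠ 0 := by
  rintro rfl
  exact hv.2 2 one_lt_two (by simpa using h0)

namespace Input

theorem wnorm_smul (M : Matrix (Fin d) (Fin d) ℝ) {m : ℝ} (hm : 0 ≤ m)
    (v : EuclideanSpace ℝ (Fin d)) : wnorm M (m • v) = m * wnorm M v := by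
  rw [wnorm, wnorm, WithLp.ofLp_smul, Matrix.mulVec_smul, dotProduct_smul, smul_dotProduct,
    smul_eq_mul, smul_eq_mul, ← mul_assoc, Real.sqrt_mul (mul_nonneg hm hm), Real.sqrt_mul_self hm]

theorem width_smul (P : Input d) (x : ℕ → EuclideanSpace ℝ (Fin d)) (t : ℕ) {m : ℝ} (hm : 0 ≤ m)
    (v : EuclideanSpace ℝ (Fin d)) : P.width x t (m • v) = m * P.width x t v := by
  rw [width, width, wnorm_smul _ hm]
  ring

theorem continuous_width (P : Input d) (x : ℕ → EuclideanSpace ℝ (Fin d)) (t : ℕ) :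
    Continuous (P.width x t) := by
  have h : Continuous fun v : EuclideanSpace ℝ (Fin d) => v.ofLp := by fun_prop
  exact continuous_const.mul
    (Real.continuous_sqrt.comp (h.dotProduct (Continuous.matrix_mulVec continuous_const h)))

theorem width_nonneg (P : Input d) (x : ℕ → EuclideanSpace ℝ (Fin d)) {t : ℕ} (hβ : 0 < P.β t)
    (v : EuclideanSpace ℝ (Fin d)) : 0 ≤ P.width x t v :=
  mul_nonneg hβ.le (Real.sqrt_nonneg _)

theorem width_pos (P : Input d) (hlam : 0 < P.lam) (x : ℕ → EuclideanSpace ℝ (Fin d)) {t : ℕ}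
    (hβ : 0 < P.β t) {v : EuclideanSpace ℝ (Fin d)} (hv : v ≠ 0) : 0 < P.width x t v := by
  refine mul_pos hβ (Real.sqrt_pos.2 ?_)
  have h : v.ofLp ≠ 0 := by simpa using hv
  simpa using (P.posDef_V hlam x t).inv.dotProduct_mulVec_pos h

theorem isCompact_X (P : Input d) (hclosed : IsClosed P.X) (hnorm : ∀ v ∈ P.X, ‖v‖ ≤ 1) :
    IsCompact P.X :=
  (isCompact_closedBall (0 : EuclideanSpace ℝ (Fin d)) 1).of_isClosed_subset hclosed
    fun v hv => by simpa using hnorm v hv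

section Sets

variable (P : Input d) (x : ℕ → EuclideanSpace ℝ (Fin d)) (z : ℕ → ℝ) {t : ℕ}

theorem isCompact_opt (hX : IsCompact P.X) : IsCompact (P.opt x z t) := by
  have h := P.continuous_width x t
  have hf : Continuous fun v => inner ℝ (P.est x z t) v - P.width x t v := by fun_prop
  exact hX.inter_right (isClosed_le hf continuous_const)

theorem isCompact_pessHat (hX : IsCompact P.X) : IsCompact (P.pessHat x z t) := by
  have h := P.continuous_width x t
  have hf : Continuous fun v => inner ℝ (P.est x z t) v + P.width x t v := by fun_prop
  have hp : IsCompact (P.pess x z t) := hX.inter_right (isClosed_le hf continuous_const)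
  exact hp.union ((P.isCompact_opt x z hX).inter_left Metric.isClosed_closedBall)

theorem smul_mem_opt (hstar : StarConvex ℝ 0 P.X) (hb : 0 < P.b)
    {v : EuclideanSpace ℝ (Fin d)} (hv : v ∈ P.opt x z t) {m : ℝ} (hm0 : 0 ≤ m) (hm1 : m ≤ 1) :
    m • v ∈ P.opt x z t := by
  refine ⟨hstar.smul_mem hv.1 hm0 hm1, ?_⟩
  rw [inner_smul_right, P.width_smul x t hm0, ← mul_sub]
  calc _ ≤ m * P.b := mul_le_mul_of_nonneg_left hv.2 hm0
    _ ≤ P.b := mul_le_of_le_one_left hb.le hm1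

theorem zero_mem_pessHat (h0 : 0 ∈ P.X) (hb : 0 < P.b) : 0 ∈ P.pessHat x z t := by
  refine Or.inl ⟨h0, ?_⟩
  have := P.width_smul x t (le_refl (0 : ℝ)) 0
  rw [zero_smul, zero_mul] at this
  simpa [this] using hb.le

theorem pessHat_subset_opt (hβ : 0 < P.β t) : P.pessHat x z t ⊆ P.opt x z t := by
  rintro v (hv | hv)
  · have := P.width_nonneg x hβ v
    exact ⟨hv.1, by linarith [hv.2]⟩
  · exact hv.2

theorem isGreatest_α (hX : IsCompact P.X) (h0 : 0 ∈ P.X) (hb : 0 < P.b) (hβ : 0 < P.β t)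
    {v : EuclideanSpace ℝ (Fin d)} (hv : v ≠ 0) :
    IsGreatest {m : ℝ | 0 ≤ m ∧ m • v ∈ P.opt x z t} (P.α x z t v) := by
  obtain ⟨g, hg⟩ := exists_isGreatest_smul_mem (P.isCompact_opt x z hX)
    (P.pessHat_subset_opt x z hβ (P.zero_mem_pessHat x z h0 hb)) hv
  rwa [α, hg.csSup_eq]

/-- The objective of C-ROFUL is the minimum of two scaled optimistic rewards. -/
theorem objective_eq (y : ℕ → ℝ) {v : EuclideanSpace ℝ (Fin d)} (hv : 0 < P.width x t v) :
    inner ℝ (P.est x y t) v + P.κTilde x y z t v * P.width x t v =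
      min (P.α x z t v * (inner ℝ (P.est x y t) v + P.width x t v))
        (inner ℝ (P.est x y t) v + (1 + 2 * P.Sθ / P.b) * P.width x t v) := by
  rw [κTilde, min_mul_of_nonneg _ _ hv.le, ← min_add_add_left, κ]
  congr 1
  field_simp
  ring

end Sets

/-- The standing assumptions on the problem, and the validity of the confidence bounds in round
`t`. -/
structure IsGoodRound (P : Input d) (θ a xstar : EuclideanSpace ℝ (Fin d))
    (x : ℕ → EuclideanSpace ℝ (Fin d)) (y z : ℕ → ℝ) (t : ℕ) : Prop where
  isClosed : IsClosed P.X
  starConvex : StarConvex ℝ 0 P.X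
  norm_le : ∀ v ∈ P.X, ‖v‖ ≤ 1
  b_pos : 0 < P.b
  Sa_pos : 0 < P.Sa
  Sθ_pos : 0 < P.Sθ
  lam_pos : 0 < P.lam
  norm_θ_le : ‖θ‖ ≤ P.Sθ
  xstar_mem : xstar ∈ P.X
  inner_xstar_le : inner ℝ a xstar ≤ P.b
  inner_xstar_pos : 0 < inner ℝ θ xstar
  β_pos : 0 < P.β t
  abs_inner_est_sub_θ_le : ∀ v, |inner ℝ (P.est x y t - θ) v| ≤ P.width x t v
  abs_inner_est_sub_a_le : ∀ v, |inner ℝ (P.est x z t - a) v| ≤ P.width x t v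

namespace IsGoodRound

variable {P : Input d} {θ a xstar : EuclideanSpace ℝ (Fin d)}
  {x : ℕ → EuclideanSpace ℝ (Fin d)} {y z : ℕ → ℝ} {t : ℕ}

/-- The rescaled optimal action witnesses that the objective is optimistic. -/
theorem exists_mem_pessBar_le_objective (h : P.IsGoodRound θ a xstar x y z t) :
    ∃ v ∈ P.pessBar x z t, inner ℝ θ xstar ≤
      min (P.α x z t v * (inner ℝ (P.est x y t) v + P.width x t v))
        (inner ℝ (P.est x y t) v + (1 + 2 * P.Sθ / P.b) * P.width x t v) := by
  obtain ⟨hclosed, hstar, hnorm, hb, hSa, hSθ, hlam, hθ, hstarX, hsafe, hpos, hβ, hgθ, hga⟩ := h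
  have hX := P.isCompact_X hclosed hnorm
  have h0 : (0 : EuclideanSpace ℝ (Fin d)) ∈ P.X := by
    simpa using hstar.smul_mem hstarX le_rfl zero_le_one
  have hne : xstar ≠ 0 := by rintro rfl; simp at hpos
  have hν : 0 < P.ν := div_pos hb hSa
  have hWs := P.width_nonneg x hβ xstar
  have ha' : inner ℝ (P.est x z t) xstar ≤ inner ℝ a xstar + P.width x t xstar := by
    have := (abs_le.1 (hga xstar)).2
    rw [inner_sub_left] at this
    linarith
  have hopt : xstar ∈ P.opt x z t := ⟨hstarX, by linarith⟩
  obtain ⟨γ, hγ⟩ := exists_isGreatest_smul_mem (P.isCompact_pessHat x z hX)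
    (P.zero_mem_pessHat x z h0 hb) hne
  have hm0 : 0 < min 1 P.ν := lt_min one_pos hν
  -- Since ‖x_*‖ ≤ 1, scaling by min(1, ν) puts x_* in the ball of radius ν and keeps it in the
  -- optimistic set.
  have hγ0 : 0 < γ := by
    refine hm0.trans_le (hγ.2 ⟨hm0.le, Or.inr ⟨?_, P.smul_mem_opt x z hstar hb hopt hm0.le
      (min_le_left _ _)⟩⟩)
    rw [mem_closedBall_zero_iff, norm_smul, Real.norm_of_nonneg hm0.le]
    calc min 1 P.ν * ‖xstar‖ ≤ P.ν * 1 :=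
          mul_le_mul (min_le_right _ _) (hnorm _ hstarX) (norm_nonneg _) hν.le
      _ = P.ν := mul_one _
  refine ⟨γ • xstar, smul_mem_maxScaled_of_isGreatest hγ hγ0, ?_⟩
  have hα : γ⁻¹ ≤ P.α x z t (γ • xstar) :=
    (P.isGreatest_α x z hX h0 hb hβ (smul_ne_zero hγ0.ne' hne)).2
      ⟨by positivity, by rwa [smul_smul, inv_mul_cancel₀ hγ0.ne', one_smul]⟩
  have hθ' : inner ℝ θ xstar ≤ inner ℝ (P.est x y t) xstar + P.width x t xstar := by
    have := (abs_le.1 (hgθ xstar)).1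
    rw [inner_sub_left] at this
    linarith
  rw [inner_smul_right, P.width_smul x t hγ0.le]
  refine le_min ?_ ?_
  · rw [← mul_add]
    calc inner ℝ θ xstar = γ⁻¹ * (γ * inner ℝ θ xstar) := by field_simp
      _ ≤ _ := mul_le_mul hα (mul_le_mul_of_nonneg_left hθ' hγ0.le) (by positivity)
          ((inv_pos.2 hγ0).le.trans hα)
  · have hC : 0 ≤ 2 * P.Sθ / P.b := by positivity
    -- This is the reward lost by shrinking x_* to γx_*; the extra coefficient 2S_θ/b of the width
    -- is designed to cover it.
    have hmain : (1 - γ) * inner ℝ θ xstar ≤ 2 * P.Sθ / P.b * (γ * P.width x t xstar) := by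
      rcases le_or_gt 1 γ with h1 | h1
      · exact (mul_nonpos_of_nonpos_of_nonneg (by linarith) hpos.le).trans (by positivity)
      -- If q ≤ b then x_* itself is pessimistically safe, contradicting γ < 1. Otherwise (b/q)x_*
      -- is safe, so γ ≥ b/q.
      · have hq : P.b ≤ γ * (inner ℝ (P.est x z t) xstar + P.width x t xstar) := by
          set q := inner ℝ (P.est x z t) xstar + P.width x t xstar with hqd
          rcases le_or_gt q P.b with h2 | h2
          · have : (1 : ℝ) ≤ γ := hγ.2 ⟨zero_le_one, by rw [one_smul]; exact Or.inl ⟨hstarX, h2⟩⟩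
            linarith
          · have hq0 : 0 < q := hb.trans h2
            have hbq : 0 ≤ P.b / q := by positivity
            have : P.b / q ≤ γ := hγ.2 ⟨hbq, Or.inl ⟨hstar.smul_mem hstarX hbq
              ((div_le_one hq0).2 h2.le), by
                rw [inner_smul_right, P.width_smul x t hbq, ← mul_add, ← hqd,
                  div_mul_cancel₀ _ hq0.ne']⟩⟩
            rwa [div_le_iff₀ hq0] at this
        -- Safety of x_* and the confidence bound give q ≤ b + 2W(x_*); insert this in b ≤ γq.
        have h3 : (1 - γ) * P.b ≤ 2 * (γ * P.width x t xstar) := by nlinarith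
        have h4 : inner ℝ θ xstar ≤ P.Sθ := by
          calc inner ℝ θ xstar ≤ ‖θ‖ * ‖xstar‖ := real_inner_le_norm _ _
            _ ≤ P.Sθ * 1 := mul_le_mul hθ (hnorm _ hstarX) (norm_nonneg _) hSθ.le
            _ = P.Sθ := mul_one _
        calc (1 - γ) * inner ℝ θ xstar ≤ (1 - γ) * P.Sθ :=
              mul_le_mul_of_nonneg_left h4 (by linarith)
          _ = P.Sθ / P.b * ((1 - γ) * P.b) := by field_simp
          _ ≤ P.Sθ / P.b * (2 * (γ * P.width x t xstar)) := by gcongr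
          _ = _ := by ring
    nlinarith

/-- The maximally scaled set need not be closed nor α_t continuous, so the objective cannot be
maximized directly. The problem is relaxed to a direction with two independent feasible scalings,
which is a continuous problem on a compact set. Pushing both scalings of a relaxed maximizer to
their largest values yields a genuine one. -/
theorem nonempty_crofulActions (h : P.IsGoodRound θ a xstar x y z t) :
    (P.crofulActions x y z t).Nonempty := by
  obtain ⟨v₀, hv₀, hle⟩ := h.exists_mem_pessBar_le_objective
  obtain ⟨hclosed, hstar, hnorm, hb, hSa, hSθ, hlam, hθ, hstarX, hsafe, hpos, hβ, hgθ, hga⟩ := h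
  have hX := P.isCompact_X hclosed hnorm
  have h0 : (0 : EuclideanSpace ℝ (Fin d)) ∈ P.X := by
    simpa using hstar.smul_mem hstarX le_rfl zero_le_one
  have hcH := P.isCompact_pessHat x z (t := t) hX
  have hcO := P.isCompact_opt x z (t := t) hX
  have h0H := P.zero_mem_pessHat x z (t := t) h0 hb
  set f : EuclideanSpace ℝ (Fin d) → ℝ := fun u => inner ℝ (P.est x y t) u + P.width x t u with hf
  set g : EuclideanSpace ℝ (Fin d) → ℝ := fun u => inner ℝ (P.est x y t) u + (1 + 2 * P.Sθ / P.b) * P.width x t u with hg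
  have hWc := P.continuous_width x t
  have hfc : Continuous f := by fun_prop
  have hgc : Continuous g := by fun_prop
  have hfs : ∀ (m : ℝ) (v : EuclideanSpace ℝ (Fin d)), 0 ≤ m → f (m • v) = m * f v := fun m v hm => by
    simp only [hf, inner_smul_right, P.width_smul x t hm]; ring
  have hgs : ∀ (m : ℝ) (v : EuclideanSpace ℝ (Fin d)), 0 ≤ m → g (m • v) = m * g v := fun m v hm => by
    simp only [hg, inner_smul_right, P.width_smul x t hm]; ring
  have hObj : ∀ v : EuclideanSpace ℝ (Fin d), v ≠ 0 → inner ℝ (P.est x y t) v + P.κTilde x y z t v * P.width x t v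
      = min (P.α x z t v * f v) (g v) := fun v hv =>
    P.objective_eq x z y (P.width_pos hlam x hβ hv)
  -- directions together with two scalings, one into each of the action sets
  set K : Set (EuclideanSpace ℝ (Fin d) × ℝ × ℝ) := {p | ‖p.1‖ = 1 ∧ 0 ≤ p.2.1 ∧ 0 ≤ p.2.2 ∧
    p.2.1 • p.1 ∈ P.opt x z t ∧ p.2.2 • p.1 ∈ P.pessHat x z t} with hK
  set G : EuclideanSpace ℝ (Fin d) × ℝ × ℝ → ℝ := fun p => min (p.2.1 * f p.1) (p.2.2 * g p.1) with hG
  have hscale : ∀ (u : EuclideanSpace ℝ (Fin d)) (m : ℝ), ‖u‖ = 1 → 0 ≤ m → m • u ∈ P.X → m ≤ 1 := fun u m hu hm h => by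
    have := hnorm _ h
    rwa [norm_smul, hu, mul_one, Real.norm_of_nonneg hm] at this
  have hHO := P.pessHat_subset_opt x z hβ
  have hKc : IsCompact K := by
    have hbig : IsCompact (Metric.closedBall (0 : EuclideanSpace ℝ (Fin d)) 1 ×ˢ Set.Icc (0 : ℝ) 1 ×ˢ Set.Icc (0 : ℝ) 1) :=
      (isCompact_closedBall _ _).prod (isCompact_Icc.prod isCompact_Icc)
    refine hbig.of_isClosed_subset ?_ ?_
    · refine (isClosed_eq continuous_fst.norm continuous_const).inter
        ((isClosed_le continuous_const continuous_snd.fst).inter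
        ((isClosed_le continuous_const continuous_snd.snd).inter (IsClosed.inter ?_ ?_)))
      · exact hcO.isClosed.preimage
          (show Continuous fun p : EuclideanSpace ℝ (Fin d) × ℝ × ℝ => p.2.1 • p.1 by fun_prop)
      · exact hcH.isClosed.preimage
          (show Continuous fun p : EuclideanSpace ℝ (Fin d) × ℝ × ℝ => p.2.2 • p.1 by fun_prop)
    · rintro ⟨u, r, s⟩ ⟨hu, hr, hs, hr', hs'⟩
      exact ⟨by simpa using hu.le, ⟨hr, hscale u r hu hr hr'.1⟩,
        ⟨hs, hscale u s hu hs (hHO hs').1⟩⟩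
  have hGc : Continuous G := by fun_prop
  have hmem : ∀ v ∈ P.pessBar x z t,
      (‖v‖⁻¹ • v, P.α x z t v * ‖v‖, ‖v‖) ∈ K ∧
      G (‖v‖⁻¹ • v, P.α x z t v * ‖v‖, ‖v‖) = min (P.α x z t v * f v) (g v) := by
    intro v hv
    have hv0 := ne_zero_of_mem_maxScaled h0H hv
    have hn : 0 < ‖v‖ := norm_pos_iff.2 hv0
    have hα := P.isGreatest_α x z hX h0 hb hβ hv0
    refine ⟨⟨?_, mul_nonneg hα.1.1 hn.le, hn.le, ?_, ?_⟩, ?_⟩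
    · rw [norm_smul, norm_inv, norm_norm, inv_mul_cancel₀ hn.ne']
    · rw [smul_smul, mul_assoc, mul_inv_cancel₀ hn.ne', mul_one]
      exact hα.1.2
    · rw [smul_smul, mul_inv_cancel₀ hn.ne', one_smul]
      exact hv.1
    · simp only [hG]
      rw [hfs _ _ (by positivity), hgs _ _ (by positivity), mul_assoc, mul_inv_cancel_left₀ hn.ne',
        mul_inv_cancel_left₀ hn.ne']
  obtain ⟨⟨u, r, s⟩, hp, hmax⟩ := hKc.exists_isMaxOn ⟨_, (hmem v₀ hv₀).1⟩ hGc.continuousOn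
  have hmax' : ∀ v ∈ P.pessBar x z t, min (P.α x z t v * f v) (g v) ≤ G (u, r, s) := by
    intro v hv
    rw [← (hmem v hv).2]
    exact hmax (hmem v hv).1
  -- Optimism makes the relaxed maximum positive. Hence f(u) and g(u) are positive, and enlarging
  -- either scaling cannot lower its entry of the minimum.
  have hGpos : 0 < G (u, r, s) := hpos.trans_le (hle.trans (hmax' v₀ hv₀))
  obtain ⟨hu, hr, hs, hrO, hsH⟩ := hp
  simp only at hu hr hs hrO hsH
  have hu0 : u ≠ 0 := by rintro rfl; simp at hu
  obtain ⟨hpr, hps⟩ := lt_min_iff.1 hGpos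
  simp only at hpr hps
  have hfu : 0 < f u := pos_of_mul_pos_right hpr hr
  have hgu : 0 < g u := pos_of_mul_pos_right hps hs
  have hs0 : 0 < s := pos_of_mul_pos_left hps hgu.le
  obtain ⟨γ, hγ⟩ := exists_isGreatest_smul_mem hcH h0H hu0
  have hsγ : s ≤ γ := hγ.2 ⟨hs, hsH⟩
  have hγ0 : 0 < γ := hs0.trans_le hsγ
  have hbar : γ • u ∈ P.pessBar x z t := smul_mem_maxScaled_of_isGreatest hγ hγ0
  have hγu : γ • u ≠ 0 := smul_ne_zero hγ0.ne' hu0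
  refine ⟨γ • u, hbar, fun v hv => ?_⟩
  simp only
  rw [hObj v (ne_zero_of_mem_maxScaled h0H hv), hObj _ hγu]
  refine (hmax' v hv).trans (min_le_min ?_ ?_)
  -- The point ru is (r/γ)(γu), so r/γ competes in the definition of α_t(γu).
  · have hα : r / γ ≤ P.α x z t (γ • u) := (P.isGreatest_α x z hX h0 hb hβ hγu).2
      ⟨by positivity, by rwa [smul_smul, div_mul_cancel₀ _ hγ0.ne']⟩
    rw [hfs _ _ hγ0.le, ← mul_assoc]
    rw [div_le_iff₀ hγ0] at hα
    exact mul_le_mul_of_nonneg_right hα hfu.le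
  · rw [hgs _ _ hγ0.le]
    exact mul_le_mul_of_nonneg_right hsγ hgu.le

/-- The instantaneous regret of C-ROFUL. -/
theorem inner_sub_le_of_mem_crofulActions (h : P.IsGoodRound θ a xstar x y z t)
    {v : EuclideanSpace ℝ (Fin d)}
    (hv : v ∈ P.crofulActions x y z t) :
    inner ℝ θ (xstar - v) ≤ 2 * (1 + P.Sθ / P.b) * P.width x t v := by
  obtain ⟨v₀, hv₀, hle⟩ := h.exists_mem_pessBar_le_objective
  obtain ⟨hclosed, hstar, hnorm, hb, hSa, hSθ, hlam, hθ, hstarX, hsafe, hpos, hβ, hgθ, hga⟩ := h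
  have h0 : (0 : EuclideanSpace ℝ (Fin d)) ∈ P.X := by
    simpa using hstar.smul_mem hstarX le_rfl zero_le_one
  have h0H := P.zero_mem_pessHat x z (t := t) h0 hb
  have h1 := hv.2 v₀ hv₀
  simp only at h1
  rw [P.objective_eq x z y (P.width_pos hlam x hβ (ne_zero_of_mem_maxScaled h0H hv₀)),
    P.objective_eq x z y (P.width_pos hlam x hβ (ne_zero_of_mem_maxScaled h0H hv.1))] at h1
  have h2 := hle.trans (h1.trans (min_le_right _ _))
  have h3 := (abs_le.1 (hgθ v)).2
  rw [inner_sub_left] at h3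
  rw [inner_sub_right]
  have : 2 * (1 + P.Sθ / P.b) * P.width x t v
      = (1 + 2 * P.Sθ / P.b) * P.width x t v + P.width x t v := by ring
  linarith

end IsGoodRound

end Input

end SafeLinearBandit

/-! ### Confidence bounds for the least squares estimates. -/

namespace SafeLinearBandit

variable {d : ℕ}

namespace Input

/-- The right-hand side of the normal equations is V_tθ plus the noise sum minus the regularization
bias λθ. -/
theorem ofLp_est_obs (P : Input d) (hlam : 0 < P.lam) (θ : EuclideanSpace ℝ (Fin d))
    (x : ℕ → EuclideanSpace ℝ (Fin d)) (e w : ℕ → ℝ) (hw : ∀ k, w k = inner ℝ θ (x k) + e k)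
    (t : ℕ) :
    (P.est x w t).ofLp
      = θ.ofLp + (P.V x t)⁻¹.mulVec (noiseSum x e t - P.lam • θ.ofLp) := by
  have hV := P.posDef_V hlam x t
  have hu : IsUnit (P.V x t).det := hV.det_pos.ne'.isUnit
  have h : ∑ k ∈ Finset.Ico 1 t, w k • (x k).ofLp
      = (P.V x t).mulVec θ.ofLp + (noiseSum x e t - P.lam • θ.ofLp) := by
    have h1 : (P.V x t).mulVec θ.ofLp
        = ∑ k ∈ Finset.Ico 1 t, inner ℝ θ (x k) • (x k).ofLp + P.lam • θ.ofLp := by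
      rw [V, Matrix.add_mulVec, Matrix.sum_mulVec, Matrix.smul_mulVec, Matrix.one_mulVec]
      congr 1
      refine Finset.sum_congr rfl fun k _ => ?_
      rw [Matrix.vecMulVec_mulVec, inner_eq_dotProduct_ofLp, dotProduct_comm]
      simp
    rw [h1, noiseSum]
    simp only [hw, add_smul, Finset.sum_add_distrib]
    abel
  rw [est, h, Matrix.mulVec_add, Matrix.mulVec_mulVec, Matrix.nonsing_inv_mul _ hu,
    Matrix.one_mulVec]

theorem S_pos (P : Input d) (hSa : 0 < P.Sa) : 0 < P.S := hSa.trans_le (le_max_left _ _)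

/-- Cauchy-Schwarz in the V_t⁻¹ form, applied to noise and bias separately. The bias contributes
λ‖θ‖_{V_t⁻¹} ≤ √λ‖θ‖ because V_t ≥ λ; this is the second term of β_t. -/
theorem abs_inner_est_sub_le (P : Input d) (hlam : 0 < P.lam) {θ : EuclideanSpace ℝ (Fin d)}
    (hθ : ‖θ‖ ≤ P.S) (x : ℕ → EuclideanSpace ℝ (Fin d)) (e w : ℕ → ℝ)
    (hw : ∀ k, w k = inner ℝ θ (x k) + e k) (t : ℕ)
    (hQ : √(noiseSum x e t ⬝ᵥ (P.V x t)⁻¹.mulVec (noiseSum x e t))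
      ≤ P.ρ * √(d * Real.log ((1 + ((t : ℝ) - 1) / P.lam) / (P.δ / 2))))
    (v : EuclideanSpace ℝ (Fin d)) : |inner ℝ (P.est x w t - θ) v| ≤ P.width x t v := by
  have hV := (P.posDef_V hlam x t).inv.posSemidef
  have h1 : inner ℝ (P.est x w t - θ) v = v.ofLp ⬝ᵥ (P.V x t)⁻¹.mulVec (noiseSum x e t)
      - P.lam * (v.ofLp ⬝ᵥ (P.V x t)⁻¹.mulVec θ.ofLp) := by
    rw [real_inner_comm, inner_eq_dotProduct_ofLp, WithLp.ofLp_sub,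
      P.ofLp_est_obs hlam θ x e w hw, add_sub_cancel_left, Matrix.mulVec_sub, dotProduct_sub,
      Matrix.mulVec_smul, dotProduct_smul, smul_eq_mul]
  have h2 := hV.abs_dotProduct_mulVec_le v.ofLp (noiseSum x e t)
  have h3 := hV.abs_dotProduct_mulVec_le v.ofLp θ.ofLp
  have h4 : P.lam * √(θ.ofLp ⬝ᵥ (P.V x t)⁻¹.mulVec θ.ofLp) ≤ √P.lam * P.S := by
    have h5 := P.lam_mul_inv_V_le hlam x t θ
    calc P.lam * √(θ.ofLp ⬝ᵥ (P.V x t)⁻¹.mulVec θ.ofLp)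
        = √P.lam * √(P.lam * (θ.ofLp ⬝ᵥ (P.V x t)⁻¹.mulVec θ.ofLp)) := by
          rw [Real.sqrt_mul hlam.le, ← mul_assoc, Real.mul_self_sqrt hlam.le]
      _ ≤ √P.lam * √(‖θ‖ ^ 2) := by gcongr
      _ = √P.lam * ‖θ‖ := by rw [Real.sqrt_sq (norm_nonneg _)]
      _ ≤ √P.lam * P.S := by gcongr
  have hn : wnorm (P.V x t)⁻¹ v = √(v.ofLp ⬝ᵥ (P.V x t)⁻¹.mulVec v.ofLp) := rfl
  rw [← hn] at h2 h3
  have hn0 : 0 ≤ wnorm (P.V x t)⁻¹ v := Real.sqrt_nonneg _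
  rw [h1, width, β]
  refine (abs_sub _ _).trans ?_
  rw [abs_mul, abs_of_pos hlam]
  calc _ ≤ wnorm (P.V x t)⁻¹ v * √(noiseSum x e t ⬝ᵥ (P.V x t)⁻¹.mulVec (noiseSum x e t))
        + P.lam * (wnorm (P.V x t)⁻¹ v * √(θ.ofLp ⬝ᵥ (P.V x t)⁻¹.mulVec θ.ofLp)) := by gcongr
    _ = (√(noiseSum x e t ⬝ᵥ (P.V x t)⁻¹.mulVec (noiseSum x e t))
        + P.lam * √(θ.ofLp ⬝ᵥ (P.V x t)⁻¹.mulVec θ.ofLp)) * wnorm (P.V x t)⁻¹ v := by ring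
    _ ≤ _ := by gcongr

/-- Taking logarithms bounds the quadratic form by 2 log(2/δ) + log(det V_t/λ^d). The determinant
term is at most d log(1 + (t-1)/λ), and d ≥ 2 absorbs the factor 2. -/
theorem noiseSum_le_of_mixture_lt (P : Input d) (hd : 2 ≤ d) (hlam : 0 < P.lam) (hδ0 : 0 < P.δ)
    (hδ1 : P.δ < 1) {x : ℕ → EuclideanSpace ℝ (Fin d)} {t : ℕ} (ht : 1 ≤ t)
    (hx : ∀ k ∈ Finset.Ico 1 t, ‖x k‖ ≤ 1) {e : ℕ → ℝ} (h : P.mixture x e t < (P.δ / 2)⁻¹) :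
    noiseSum x e t ⬝ᵥ (P.V x t)⁻¹.mulVec (noiseSum x e t)
      ≤ d * Real.log ((1 + ((t : ℝ) - 1) / P.lam) / (P.δ / 2)) := by
  have hD : 0 < (P.V x t).det / P.lam ^ d := div_pos (P.posDef_V hlam x t).det_pos (by positivity)
  have hδ : 0 < P.δ / 2 := by positivity
  have ht' : (0 : ℝ) ≤ (t : ℝ) - 1 := by
    have : (1 : ℝ) ≤ t := by exact_mod_cast ht
    linarith
  have hd' : (2 : ℝ) ≤ d := by exact_mod_cast hd
  have h1 := P.log_det_V_div_le (by omega) hlam ht hx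
  rw [mixture, div_lt_iff₀ (Real.sqrt_pos.2 hD)] at h
  have h2 := Real.log_le_log (Real.exp_pos _) h.le
  rw [Real.log_exp, Real.log_mul (by positivity) (Real.sqrt_pos.2 hD).ne', Real.log_sqrt hD.le]
    at h2
  have h3 : 0 ≤ Real.log (P.δ / 2)⁻¹ := Real.log_nonneg ((one_le_inv₀ hδ).2 (by linarith))
  have h4 : Real.log (1 + ((t : ℝ) - 1) / (P.lam * d)) ≤ Real.log (1 + ((t : ℝ) - 1) / P.lam) := by
    refine Real.log_le_log (by positivity) ?_
    gcongr
    nlinarith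
  rw [div_eq_mul_inv (1 + _) (P.δ / 2), Real.log_mul (by positivity) (by positivity)]
  nlinarith

theorem β_pos (P : Input d) (hρ : 0 ≤ P.ρ) (hlam : 0 < P.lam) (hSa : 0 < P.Sa) (t : ℕ) :
    0 < P.β t := by
  have := P.S_pos hSa
  have := Real.sqrt_pos.2 hlam
  unfold β
  positivity

theorem β_le_β (P : Input d) (hρ : 0 ≤ P.ρ) (hlam : 0 < P.lam) (hδ0 : 0 < P.δ) {s t : ℕ}
    (hs : 1 ≤ s) (hst : s ≤ t) : P.β s ≤ P.β t := by
  have h1 : (1 : ℝ) ≤ s := by exact_mod_cast hs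
  have h2 : (s : ℝ) ≤ t := by exact_mod_cast hst
  have h3 : 0 ≤ ((s : ℝ) - 1) / P.lam := div_nonneg (by linarith) hlam.le
  unfold β
  gcongr

end Input

section Noise

variable {Ω : Type*}

theorem history_mono (x : ℕ → Ω → EuclideanSpace ℝ (Fin d)) (ξ : ℕ → Ω → ℝ) {s t : ℕ}
    (hst : s ≤ t) : history x ξ s ≤ history x ξ t :=
  sup_le_sup (biSup_mono fun k hk => by simp only [Finset.mem_Icc] at hk ⊢; omega)
    (biSup_mono fun k hk => by simp only [Finset.mem_Ico] at hk ⊢; omega)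

theorem history_le [m0 : MeasurableSpace Ω] {x : ℕ → Ω → EuclideanSpace ℝ (Fin d)}
    {ξ : ℕ → Ω → ℝ} {T t : ℕ} (ht : t ≤ T) (hx : ∀ t ∈ Finset.Icc 1 T, Measurable (x t))
    (hξ : ∀ t ∈ Finset.Icc 1 T, Measurable (ξ t)) : history x ξ t ≤ m0 :=
  sup_le
    (iSup₂_le fun k hk => (hx k (by simp only [Finset.mem_Icc] at hk ⊢; omega)).comap_le)
    (iSup₂_le fun k hk =>
      (hξ k (by simp only [Finset.mem_Ico, Finset.mem_Icc] at hk ⊢; omega)).comap_le)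

theorem measurable_history_action (x : ℕ → Ω → EuclideanSpace ℝ (Fin d)) (ξ : ℕ → Ω → ℝ) {k t : ℕ}
    (h1 : 1 ≤ k) (h2 : k ≤ t) : Measurable[history x ξ t] (x k) := by
  rw [measurable_iff_comap_le]
  exact le_sup_of_le_left (le_iSup₂_of_le k (Finset.mem_Icc.2 ⟨h1, h2⟩) le_rfl)

theorem measurable_history_noise (x : ℕ → Ω → EuclideanSpace ℝ (Fin d)) (ξ : ℕ → Ω → ℝ) {k t : ℕ}
    (h1 : 1 ≤ k) (h2 : k < t) : Measurable[history x ξ t] (ξ k) := by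
  rw [measurable_iff_comap_le]
  exact le_sup_of_le_right (le_iSup₂_of_le k (Finset.mem_Ico.2 ⟨h1, h2⟩) le_rfl)

/-- The nonnegative function exp(e) + exp(-e) - 2 has integral at most 0, and it vanishes only where
e = 0. This settles ρ = 0, where the noise cannot be divided by ρ. -/
theorem ae_eq_zero_of_condExp_exp_le {m m0 : MeasurableSpace Ω} {μ : Measure Ω}
    [IsProbabilityMeasure μ] (hm : m ≤ m0) {e : Ω → ℝ}
    (h : ∀ s : ℝ, Integrable (fun ω => Real.exp (s * e ω)) μ ∧
      μ[fun ω => Real.exp (s * e ω) | m] ≤ᵐ[μ] fun _ => (1 : ℝ)) : e =ᵐ[μ] 0 := by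
  have hint : ∀ s : ℝ, ∫ ω, Real.exp (s * e ω) ∂μ ≤ 1 := by
    intro s
    rw [← integral_condExp hm]
    calc _ ≤ ∫ _, (1 : ℝ) ∂μ :=
          integral_mono_ae integrable_condExp (integrable_const _) (h s).2
      _ = 1 := by simp
  have hpt : ∀ r : ℝ, 0 ≤ Real.exp (1 * r) + Real.exp (-1 * r) - 2 := fun r => by
    have h1 := Real.add_one_le_exp (1 * r)
    have h2 := Real.add_one_le_exp (-1 * r)
    linarith
  have hI : Integrable (fun ω => Real.exp (1 * e ω) + Real.exp (-1 * e ω) - 2) μ :=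
    ((h 1).1.add (h (-1)).1).sub (integrable_const _)
  have h0 : ∫ ω, (Real.exp (1 * e ω) + Real.exp (-1 * e ω) - 2) ∂μ = 0 := by
    refine le_antisymm ?_ (integral_nonneg fun ω => hpt _)
    have hadd : Integrable (fun ω => Real.exp (1 * e ω) + Real.exp (-1 * e ω)) μ :=
      (h 1).1.add (h (-1)).1
    rw [integral_sub hadd (integrable_const _), integral_add (h 1).1 (h (-1)).1]
    have := hint 1
    have := hint (-1)
    simp only [integral_const, probReal_univ, smul_eq_mul]
    linarith
  rw [integral_eq_zero_iff_of_nonneg (fun ω => hpt _) hI] at h0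
  filter_upwards [h0] with ω hω
  by_contra hne
  simp only [Pi.zero_apply] at hω hne
  have h1 := Real.add_one_lt_exp (x := 1 * e ω) (by simpa using hne)
  have h2 := Real.add_one_lt_exp (x := -1 * e ω) (by simpa using hne)
  linarith

/-- The self-normalized confidence bound holds in all rounds with high probability. -/
theorem Input.measure_exists_lt_noiseSum_le [MeasurableSpace Ω] {μ : Measure Ω}
    [IsProbabilityMeasure μ] (P : Input d) (hd : 2 ≤ d) (hlam : 0 < P.lam) (hρ : 0 ≤ P.ρ)
    (hδ0 : 0 < P.δ) (hδ1 : P.δ < 1) {T : ℕ} {x : ℕ → Ω → EuclideanSpace ℝ (Fin d)}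
    {ξ : ℕ → Ω → ℝ} (hx : ∀ t ∈ Finset.Icc 1 T, Measurable (x t))
    (hx1 : ∀ ω, ∀ t ∈ Finset.Icc 1 T, ‖x t ω‖ ≤ 1) (hξ : CondSubgaussianNoise μ x ξ P.ρ T) :
    μ {ω | ∃ t, 1 ≤ t ∧ t ≤ T ∧ P.ρ * √(d * Real.log ((1 + ((t : ℝ) - 1) / P.lam) / (P.δ / 2)))
      < √(noiseSum (fun k => x k ω) (fun k => ξ k ω) t ⬝ᵥ
        (P.V (fun k => x k ω) t)⁻¹.mulVec (noiseSum (fun k => x k ω) (fun k => ξ k ω) t))}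
      ≤ ENNReal.ofReal (P.δ / 2) := by
  have hle : ∀ t, t ≤ T → history x ξ t ≤ _ := fun t ht =>
    history_le ht hx fun k hk => (hξ k hk).1
  rcases hρ.eq_or_lt with h0 | h0
  · have hae : ∀ᵐ ω ∂μ, ∀ t ∈ Finset.Icc 1 T, ξ t ω = 0 := by
      rw [Filter.eventually_all_finset]
      intro t ht
      refine ae_eq_zero_of_condExp_exp_le (hle t (Finset.mem_Icc.1 ht).2) fun s => ?_
      simpa [← h0] using (hξ t ht).2.2.2 s
    refine le_trans (le_of_eq (measure_mono_null ?_ (ae_iff.1 hae))) zero_le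
    rintro ω ⟨t, h1, h2, h3⟩ hω
    have : noiseSum (fun k => x k ω) (fun k => ξ k ω) t = 0 :=
      Finset.sum_eq_zero fun k hk => by
        have hk0 := hω k (by simp only [Finset.mem_Ico, Finset.mem_Icc] at hk ⊢; omega)
        simp [hk0]
    simp [this, ← h0] at h3
  -- The noise is normalized to e = ξ/ρ, which is conditionally 1-subgaussian; the factor ρ returns
  -- when the noise sum is scaled back.
  · have key := P.measure_exists_le_mixture (μ := μ) hlam (T := T) (history x ξ)
      (fun s t h => history_mono x ξ h) (fun t _ h => hle t h) (x := x)
      (e := fun t ω => P.ρ⁻¹ * ξ t ω)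
      (fun k t h1 h2 _ => measurable_history_action x ξ h1 h2)
      (fun k t h1 h2 _ => (measurable_history_noise x ξ h1 h2).const_mul _)
      (fun t h1 h2 => ?_) (c := P.δ / 2) (by positivity)
    · refine (measure_mono ?_).trans key
      rintro ω ⟨t, h1, h2, h3⟩
      refine ⟨t, h1, h2, le_of_not_gt fun hlt => ?_⟩
      have hQ := P.noiseSum_le_of_mixture_lt hd hlam hδ0 hδ1 h1 (x := fun k => x k ω)
        (fun k hk => hx1 ω k (by simp only [Finset.mem_Ico, Finset.mem_Icc] at hk ⊢; omega)) hlt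
      have hs : noiseSum (fun k => x k ω) (fun k => ξ k ω) t
          = P.ρ • noiseSum (fun k => x k ω) (fun k => P.ρ⁻¹ * ξ k ω) t := by
        simp only [noiseSum, Finset.smul_sum, smul_smul, mul_inv_cancel_left₀ h0.ne']
      rw [hs, Matrix.mulVec_smul, dotProduct_smul, smul_dotProduct, smul_eq_mul, smul_eq_mul,
        ← mul_assoc, Real.sqrt_mul (mul_self_nonneg _), Real.sqrt_mul_self hρ] at h3
      exact absurd h3 (not_lt.2 (mul_le_mul_of_nonneg_left (Real.sqrt_le_sqrt hQ) hρ))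
    · have ht : t ∈ Finset.Icc 1 T := Finset.mem_Icc.2 ⟨h1, h2⟩
      refine ⟨(hξ t ht).1.const_mul _, fun s => ?_⟩
      have := (hξ t ht).2.2.2 (s * P.ρ⁻¹)
      simp only [← mul_assoc]
      refine ⟨this.1, this.2.trans_eq (Filter.Eventually.of_forall fun ω => ?_)⟩
      simp only [mul_pow, inv_pow]
      rw [inv_mul_cancel_right₀ (by positivity)]

end Noise

end SafeLinearBandit

/-! ### Summing the regret and the final union bound. -/

namespace SafeLinearBandit

theorem Input.regret_le_of_forall {d : ℕ} {Ω : Type*} (P : Input d) (hd : 1 ≤ d) (hb : 0 < P.b)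
    (hSa : 0 < P.Sa) (hSθ : 0 < P.Sθ) (hρ : 0 ≤ P.ρ) (hδ0 : 0 < P.δ) (hlam : 1 ≤ P.lam)
    {θ xstar : EuclideanSpace ℝ (Fin d)} {T : ℕ} (x : ℕ → Ω → EuclideanSpace ℝ (Fin d)) {ω : Ω}
    (hx1 : ∀ t ∈ Finset.Icc 1 T, ‖x t ω‖ ≤ 1)
    (h : ∀ t ∈ Finset.Icc 1 T, inner ℝ θ (xstar - x t ω)
      ≤ 2 * (1 + P.Sθ / P.b) * P.width (fun k => x k ω) t (x t ω)) :
    regret θ xstar x T ω ≤ 2 * (1 + P.Sθ / P.b) * P.β T *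
      √(2 * d * T * Real.log (1 + T / (P.lam * d))) := by
  have hlam0 : 0 < P.lam := by linarith
  have hC : 0 ≤ 2 * (1 + P.Sθ / P.b) := by positivity
  have hβT := (P.β_pos hρ hlam0 hSa T).le
  set n : ℕ → ℝ := fun t => wnorm (P.V (fun k => x k ω) t)⁻¹ (x t ω)
  have hn : ∀ t, 0 ≤ n t := fun t => Real.sqrt_nonneg _
  have hsum : ∑ t ∈ Finset.Icc 1 T, n t ≤ √(2 * d * T * Real.log (1 + T / (P.lam * d))) := by
    refine Real.le_sqrt_of_sq_le ?_
    have h1 : (∑ t ∈ Finset.Icc 1 T, n t) ^ 2 ≤ (T : ℝ) * ∑ t ∈ Finset.Icc 1 T, n t ^ 2 := by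
      simpa using sq_sum_le_card_mul_sum_sq (s := Finset.Icc 1 T) (f := n)
    have h2 := P.sum_sq_wnorm_le hd hlam (x := fun k => x k ω) hx1
    calc _ ≤ (T : ℝ) * ∑ t ∈ Finset.Icc 1 T, n t ^ 2 := h1
      _ ≤ (T : ℝ) * (2 * d * Real.log (1 + T / (P.lam * d))) := by gcongr
      _ = _ := by ring
  calc regret θ xstar x T ω
      ≤ ∑ t ∈ Finset.Icc 1 T, 2 * (1 + P.Sθ / P.b) * (P.β T * n t) := by
        refine Finset.sum_le_sum fun t ht => (h t ht).trans ?_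
        obtain ⟨h1, h2⟩ := Finset.mem_Icc.1 ht
        exact mul_le_mul_of_nonneg_left
          (mul_le_mul_of_nonneg_right (P.β_le_β hρ hlam0 hδ0 h1 h2) (hn t)) hC
    _ = 2 * (1 + P.Sθ / P.b) * P.β T * ∑ t ∈ Finset.Icc 1 T, n t := by
        rw [Finset.mul_sum]
        exact Finset.sum_congr rfl fun t _ => by ring
    _ ≤ _ := by gcongr

end SafeLinearBandit

open SafeLinearBandit in
theorem corollary2 {d : ℕ} (hd : 2 ≤ d) (P : Input d)
    (hclosed : IsClosed P.X) (hstar : StarConvex ℝ 0 P.X) (hnorm : ∀ v ∈ P.X, ‖v‖ ≤ 1)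
    (hb : 0 < P.b) (hSa : 0 < P.Sa) (hSθ : 0 < P.Sθ) (hν : P.ν ≤ 1)
    (hρ : 0 ≤ P.ρ) (hδ0 : 0 < P.δ) (hδ1 : P.δ < 1) (hlam : 1 ≤ P.lam)
    (θ a xstar : EuclideanSpace ℝ (Fin d))
    (hθ : ‖θ‖ ≤ P.Sθ) (ha : ‖a‖ ≤ P.Sa)
    (hopt : xstar ∈ argmaxOn (fun v => inner ℝ θ v) {v | v ∈ P.X ∧ inner ℝ a v ≤ P.b})
    (hpos : 0 < inner ℝ θ xstar)
    (T : ℕ) {Ω : Type*} [MeasurableSpace Ω] (μ : MeasureTheory.Measure Ω)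
    [MeasureTheory.IsProbabilityMeasure μ]
    (x : ℕ → Ω → EuclideanSpace ℝ (Fin d)) (ε η : ℕ → Ω → ℝ)
    (hx : ∀ t ∈ Finset.Icc 1 T, Measurable (x t))
    (hε : CondSubgaussianNoise μ x ε P.ρ T) (hη : CondSubgaussianNoise μ x η P.ρ T)
    (hrun : IsCROFULRun P θ a x ε η T) :
    ENNReal.ofReal (1 - P.δ) ≤
      μ {ω | regret θ xstar x T ω ≤
        2 * (1 + P.Sθ / P.b) * P.β T *
          Real.sqrt (2 * d * T * Real.log (1 + T / (P.lam * d)))} := by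
  have hlam0 : 0 < P.lam := by linarith
  have hx1 : ∀ ω, ∀ t ∈ Finset.Icc 1 T, ‖x t ω‖ ≤ 1 := fun ω t ht => hnorm _ (hrun ω t ht).1
  have hBε := P.measure_exists_lt_noiseSum_le hd hlam0 hρ hδ0 hδ1 hx hx1 hε
  have hBη := P.measure_exists_lt_noiseSum_le hd hlam0 hρ hδ0 hδ1 hx hx1 hη
  set Bε := {ω | ∃ t, 1 ≤ t ∧ t ≤ T ∧
    P.ρ * √(d * Real.log ((1 + ((t : ℝ) - 1) / P.lam) / (P.δ / 2)))
      < √(Input.noiseSum (fun k => x k ω) (fun k => ε k ω) t ⬝ᵥ (P.V (fun k => x k ω) t)⁻¹.mulVec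
        (Input.noiseSum (fun k => x k ω) (fun k => ε k ω) t))} with hBεd
  set Bη := {ω | ∃ t, 1 ≤ t ∧ t ≤ T ∧
    P.ρ * √(d * Real.log ((1 + ((t : ℝ) - 1) / P.lam) / (P.δ / 2)))
      < √(Input.noiseSum (fun k => x k ω) (fun k => η k ω) t ⬝ᵥ (P.V (fun k => x k ω) t)⁻¹.mulVec
        (Input.noiseSum (fun k => x k ω) (fun k => η k ω) t))} with hBηd
  set G := {ω | regret θ xstar x T ω ≤ 2 * (1 + P.Sθ / P.b) * P.β T *
    Real.sqrt (2 * d * T * Real.log (1 + T / (P.lam * d)))} with hG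
  have hgood : ∀ ω, ω ∉ Bε → ω ∉ Bη → ω ∈ G := by
    intro ω h1 h2
    simp only [hBεd, hBηd, Set.mem_ofPred_eq, not_exists, not_and, not_lt] at h1 h2
    refine P.regret_le_of_forall (by omega) hb hSa hSθ hρ hδ0 hlam x (hx1 ω) fun t ht => ?_
    obtain ⟨ht1, htT⟩ := Finset.mem_Icc.1 ht
    have hround : P.IsGoodRound θ a xstar (fun k => x k ω) (obs θ x ε ω) (obs a x η ω) t :=
      ⟨hclosed, hstar, hnorm, hb, hSa, hSθ, hlam0, hθ, hopt.1.1, hopt.1.2, hpos,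
        P.β_pos hρ hlam0 hSa t,
        P.abs_inner_est_sub_le hlam0 (hθ.trans (le_max_right _ _)) _ (fun k => ε k ω) _
          (fun k => rfl) t (h1 t ht1 htT),
        P.abs_inner_est_sub_le hlam0 (ha.trans (le_max_left _ _)) _ (fun k => η k ω) _
          (fun k => rfl) t (h2 t ht1 htT)⟩
    exact hround.inner_sub_le_of_mem_crofulActions
      ((hrun ω t ht).2 hround.nonempty_crofulActions)
  -- Only monotonicity and subadditivity of `μ` enter, so neither `G` nor the bad events have to be
  -- measurable.
  have hcover : (1 : ENNReal) ≤ μ G + ENNReal.ofReal P.δ := by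
    calc (1 : ENNReal) = μ Set.univ := measure_univ.symm
      _ ≤ μ (G ∪ (Bε ∪ Bη)) := by
          refine measure_mono fun ω _ => ?_
          by_cases h1 : ω ∈ Bε
          · exact Or.inr (Or.inl h1)
          by_cases h2 : ω ∈ Bη
          · exact Or.inr (Or.inr h2)
          · exact Or.inl (hgood ω h1 h2)
      _ ≤ μ G + (μ Bε + μ Bη) := by
          refine (measure_union_le _ _).trans ?_
          gcongr
          exact measure_union_le _ _
      _ ≤ μ G + (ENNReal.ofReal (P.δ / 2) + ENNReal.ofReal (P.δ / 2)) := by gcongr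
      _ = _ := by rw [← ENNReal.ofReal_add (by positivity) (by positivity), add_halves]
  rw [ENNReal.ofReal_sub _ hδ0.le, ENNReal.ofReal_one]
  exact tsub_le_iff_right.2 hcover
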